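/- Let $k$ be a field of characteristic zero. Let $\mathcal H_{CK}$ be the free commutative $k$-algebra on the nonempty (non-planar, finite) rooted trees; its basis consists of the rooted forests, and its unit is the empty forest $\emptyset$. Its (Connes–Kreimer) coproduct is the algebra morphism given on a tree $t$ by $\Delta_{CK}(t)=\sum v\otimes w$, the sum running over the partitions $V\amalg W$ of the vertex set of $t$ with $W<V$ (every $x\in W$ and $y\in V$ that are comparable satisfy $x<y$, the root being the least vertex), where $v,w$ are the forests induced on $V,W$. Let $\mathcal H$ be the free commutative $k$-algebra on the rooted trees with at least one edge; its unit is identified with the one-vertex tree $\bullet$, and its coproduct is the algebra morphism given on a tree by $\Delta(t)=\sum_{s\subseteq t}s\otimes t/s$, where $s$ runs over the subforests of $t$ (the trivial subforest $\bullet$, or a collection of pairwise disjoint subtrees each having at least one edge) and $t/s$ is obtained by contracting each component of $s$ to a vertex. Let $\Phi:\mathcal H_{CK}\to\mathcal H\otimes\mathcal H_{CK}$ and $\Psi:\mathcal H_{CK}\to\mathcal H_{CK}\otimes\mathcal H$ be the algebra morphisms with $\Phi(t)=\Psi(t)=\Delta(t)$ for every nonempty tree $t$, where $\Delta(\bullet)=\bullet\otimes\bullet$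 and where the factor in $\mathcal H_{CK}$ is read as a forest, the trivial subforest (resp. the fully contracted tree) being the tree $\bullet$ of $\mathcal H_{CK}$. For linear forms $\alpha$ on $\mathcal H$ and $b,c$ on $\mathcal H_{CK}$ define the linear forms on $\mathcal H_{CK}$ $$\alpha\star b=(\alpha\otimes b)\circ\Phi,\qquad b\star\alpha=(b\otimes\alpha)\circ\Psi,\qquad b*c=(b\otimes c)\circ\Delta_{CK}.$$ Let $(\delta_s)$ and $(Z_s)$ be the bases dual to the forest bases of $\mathcal H_{CK}$ and $\mathcal H$, and let $\varepsilon=\delta_\emptyset$, the co-unit of $\mathcal H_{CK}$; $Z_\bullet$ corresponds to the unit of $\mathcal H$. Let $\varphi$ be a character of $\mathcal H$ (a unital algebra morphism $\mathcal H\to k$), $\alpha$ a linear form on $\mathcal H$, and $b,c$ linear forms on $\mathcal H_{CK}$. Then: 1. $\alpha\star\varepsilon=\varepsilon\star\alpha=\alpha(\bullet)\,\varepsilon$; 2. $\alpha\star\delta_\bullet=\delta_\bullet\star\alpha=\alpha$, where on the right $\alpha$ stands for the linear form on $\mathcal H_{CK}$ that coincides with $\alpha$ on every nonempty tree and vanishes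 on $\emptyset$ and on the forests with at least two components; 3. $Z_\bullet\star b=b\star Z_\bullet=b$; 4. $\varphi\star(b*c)=(\varphi\star b)*(\varphi\star c)$; 5. if $b$ is invertible for $*$ (with unit $\varepsilon$), then $\varphi\star b$ is invertible for $*$, and its unique inverse is $(\varphi\star b)^{*-1}=\varphi\star b^{*-1}$. -/

import Mathlib

open scoped TensorProduct

noncomputable section

namespace TreeHopf

open scoped Classical

/-- A finite rooted forest, given by its finite set of vertices and by the partial order in which
`x ≤ y` means that the path from a root to `y` passes through `x`. The vertices below a given vertex
form a chain. The edges are the covering pairs of this order; an edge is recorded by its upper end,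
so the edges correspond to the vertices that are not roots. -/
structure Forest where
  verts : Finset ℕ
  le : ℕ → ℕ → Prop
  le_refl : ∀ x ∈ verts, le x x
  le_antisymm : ∀ x ∈ verts, ∀ y ∈ verts, le x y → le y x → x = y
  le_trans : ∀ x ∈ verts, ∀ y ∈ verts, ∀ z ∈ verts, le x y → le y z → le x z
  le_chain : ∀ x ∈ verts, ∀ y ∈ verts, ∀ z ∈ verts, le x z → le y z → le x y ∨ le y x

namespace Forest

/-- The roots are the minimal vertices. -/
def roots (F : Forest) : Finset ℕ :=
  F.verts.filter fun r => ∀ x ∈ F.verts, F.le x r → x = r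

/-- A nonempty rooted tree: one vertex, the root, lies below all the others. -/
def IsTree (F : Forest) : Prop :=
  ∃ r ∈ F.verts, ∀ x ∈ F.verts, F.le r x

/-- Isomorphism of rooted forests (not respecting any planar structure). -/
def Iso (F G : Forest) : Prop :=
  ∃ e : F.verts ≃ G.verts, ∀ x y : F.verts, F.le x y ↔ G.le (e x) (e y)

/-- The forest with vertices in `A` and the induced order. -/
def restrict (F : Forest) (A : Finset ℕ) : Forest where
  verts := F.verts ∩ A
  le := F.le
  le_refl x hx := F.le_refl x (Finset.mem_inter.1 hx).1
  le_antisymm x hx y hy :=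
    F.le_antisymm x (Finset.mem_inter.1 hx).1 y (Finset.mem_inter.1 hy).1
  le_trans x hx y hy z hz :=
    F.le_trans x (Finset.mem_inter.1 hx).1 y (Finset.mem_inter.1 hy).1 z (Finset.mem_inter.1 hz).1
  le_chain x hx y hy z hz :=
    F.le_chain x (Finset.mem_inter.1 hx).1 y (Finset.mem_inter.1 hy).1 z (Finset.mem_inter.1 hz).1

/-- The vertices above `r`; for a root `r`, the connected component of `r`. -/
def above (F : Forest) (r : ℕ) : Forest :=
  F.restrict (F.verts.filter fun x => F.le r x)

theorem above_isTree (F : Forest) {r : ℕ} (hr : r ∈ F.roots) : (F.above r).IsTree := by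
  have h : r ∈ F.verts := (Finset.mem_filter.1 hr).1
  refine ⟨r, ?_, fun x hx => ?_⟩
  · simp [above, restrict, h, F.le_refl r h]
  · simp only [above, restrict, Finset.mem_inter, Finset.mem_filter] at hx
    exact hx.2.2

/-- The edges of `F`, recorded by their upper ends. -/
def edges (F : Forest) : Finset ℕ := F.verts \ F.roots

/-- The spanning subforest of `F` with set of edges `S`: now `x ≤ y` if all the edges on the path
from `x` up to `y` belong to `S`. -/
def spanning (F : Forest) (S : Finset ℕ) : Forest where
  verts := F.verts
  le x y := F.le x y ∧ ∀ z ∈ F.verts, F.le x z → z ≠ x → F.le z y → z ∈ S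
  le_refl x hx :=
    ⟨F.le_refl x hx, fun z hz h1 h2 h3 => absurd (F.le_antisymm z hz x hx h3 h1) h2⟩
  le_antisymm x hx y hy h1 h2 := F.le_antisymm x hx y hy h1.1 h2.1
  le_trans x hx y hy z hz h1 h2 := by
    refine ⟨F.le_trans x hx y hy z hz h1.1 h2.1, fun w hw hxw hne hwz => ?_⟩
    rcases F.le_chain w hw y hy z hz hwz h2.1 with h | h
    · exact h1.2 w hw hxw hne h
    · by_cases hwy : w = y
      · exact h1.2 w hw hxw hne (hwy ▸ F.le_refl w hw)
      · exact h2.2 w hw h hwy hwz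
  le_chain x hx y hy z hz h1 h2 := by
    rcases F.le_chain x hx y hy z hz h1.1 h2.1 with h | h
    · exact Or.inl ⟨h, fun w hw hxw hne hwy =>
        h1.2 w hw hxw hne (F.le_trans w hw y hy z hz hwy h2.1)⟩
    · exact Or.inr ⟨h, fun w hw hxw hne hwy =>
        h2.2 w hw hxw hne (F.le_trans w hw x hx z hz hwy h1.1)⟩

/-- The forest obtained from `F` by contracting all the edges in `S`. The vertex onto which a
component of the spanning subforest is contracted is represented by the lowest vertex of that
component, and these are the vertices that are not the upper end of an edge in `S`. The path from a
root to the component of `y` meets the component of `x` if and only if it passes through the lowest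
vertex of the latter, so the order is the induced one. -/
def contract (F : Forest) (S : Finset ℕ) : Forest := F.restrict (F.verts \ S)

/-- The sets `V` of vertices such that, with `W` the complementary set, `W < V`: whenever `x ∈ W`
and `y ∈ V` are comparable, `x < y`. Both `V` and `W` are then convex, so the induced order on each
of them is the one given by the edges that link two of its elements. -/
def crowns (F : Forest) : Finset (Finset ℕ) :=
  F.verts.powerset.filter fun V =>
    ∀ x ∈ F.verts \ V, ∀ y ∈ V, (F.le x y ∨ F.le y x) → (F.le x y ∧ x ≠ y)

/-- The forest with a single vertex. -/
def point : Forest where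
  verts := {0}
  le x y := x = y
  le_refl _ _ := rfl
  le_antisymm _ _ _ _ h _ := h
  le_trans _ _ _ _ _ _ h h' := h.trans h'
  le_chain _ _ _ _ _ _ h h' := Or.inl (h.trans h'.symm)

end Forest

/-- Isomorphism of nonempty rooted trees. -/
instance treeSetoid : Setoid {F : Forest // F.IsTree} where
  r F G := F.1.Iso G.1
  iseqv :=
    { refl := fun _ => ⟨Equiv.refl _, fun _ _ => Iff.rfl⟩
      symm := fun ⟨e, he⟩ => ⟨e.symm, fun x y => by simp [he]⟩
      trans := fun ⟨e, he⟩ ⟨f, hf⟩ => ⟨e.trans f, fun x y => by simp [he, hf]⟩ }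

/-- Nonempty (non-planar) rooted trees, i.e. isomorphism classes. -/
def RTree : Type := Quotient treeSetoid

namespace RTree

/-- A representative of the isomorphism class `t`. -/
def rep (t : RTree) : Forest := (Quotient.out t).1

/-- The tree `•` with one vertex. -/
def dot : RTree := Quotient.mk treeSetoid ⟨Forest.point, 0, by simp [Forest.point], by
  intro x hx; simpa [Forest.point, eq_comm] using hx⟩

end RTree

/-- The connected component of the root `r` of a forest. -/
def Forest.component (F : Forest) (r : F.roots) : RTree :=
  Quotient.mk treeSetoid ⟨F.above r, F.above_isTree r.2⟩

variable (k : Type*) [Field k]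

/-- The Connes–Kreimer algebra: the free commutative algebra on the nonempty rooted trees. -/
abbrev HCK : Type _ := MvPolynomial RTree k

/-- The algebra `H`: the free commutative algebra on the rooted trees with at least one edge, i.e.
on the nonempty rooted trees other than `•`. -/
abbrev H : Type _ := MvPolynomial {t : RTree // t ≠ RTree.dot} k

/-- A rooted forest as an element of `HCK`: the product of its components. -/
def Forest.toHCK (F : Forest) : HCK k :=
  ∏ r : F.roots, MvPolynomial.X (F.component r)

/-- A nonempty rooted tree as an element of `H`, where `•` is identified with the unit. -/
def RTree.toH (t : RTree) : H k :=
  if h : t = RTree.dot then 1 else MvPolynomial.X ⟨t, h⟩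

/-- A rooted forest as an element of `H`: the product of its components, where `•` is identified
with the unit. -/
def Forest.toH (F : Forest) : H k :=
  ∏ r : F.roots, (F.component r).toH k

/-- The coproduct of `H`, the algebra morphism with `Δ(t) = ∑ s ⊗ t/s`, the sum over all the
subforests `s` of the tree `t`. A subforest, a collection of disjoint subtrees each having at least
one edge, is determined by its set of edges, which can be any set of edges of `t` (the empty set
gives the trivial subforest `•`, the unit). -/
def coproduct : H k →ₐ[k] H k ⊗[k] H k :=
  MvPolynomial.aeval fun t =>
    ∑ S ∈ t.1.rep.edges.powerset,
      (t.1.rep.spanning S).toH k ⊗ₜ[k] (t.1.rep.contract S).toH k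

/-- The coproduct of the Connes–Kreimer algebra, the algebra morphism with `Δ(t) = ∑ v ⊗ w`, the sum
over all the partitions of the vertices of `t` into `V` (crown) and `W` (trunk) with `W < V`. -/
def coproductCK : HCK k →ₐ[k] HCK k ⊗[k] HCK k :=
  MvPolynomial.aeval fun t =>
    ∑ V ∈ t.rep.crowns,
      (t.rep.restrict V).toHCK k ⊗ₜ[k] (t.rep.restrict (t.rep.verts \ V)).toHCK k

/-- The linear embedding of `H` into `HCK` which sends the unit of `H` to the tree `•`, and each
other forest without one-vertex components to itself. -/
def incl : H k →ₗ[k] HCK k :=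
  (MvPolynomial.basisMonomials _ k).constr k fun m =>
    if m = 0 then MvPolynomial.X RTree.dot
    else MvPolynomial.rename Subtype.val (MvPolynomial.monomial m (1 : k))

/-- The left coaction: the algebra morphism `HCK → H ⊗ HCK` with `Φ(t) = Δ(t)` for each nonempty
tree `t`. -/
def Phi : HCK k →ₐ[k] H k ⊗[k] HCK k :=
  MvPolynomial.aeval fun t => (incl k).lTensor (H k) (coproduct k (t.toH k))

/-- The right coaction: the algebra morphism `HCK → HCK ⊗ H` with `Ψ(t) = Δ(t)` for each nonempty
tree `t`. -/
def Psi : HCK k →ₐ[k] HCK k ⊗[k] H k :=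
  MvPolynomial.aeval fun t => (incl k).rTensor (H k) (coproduct k (t.toH k))

variable {k}

/-- `α ⋆ b = m ∘ (α ⊗ b) ∘ Φ`. -/
def actL (α : H k →ₗ[k] k) (b : HCK k →ₗ[k] k) : HCK k →ₗ[k] k :=
  LinearMap.mul' k k ∘ₗ TensorProduct.map α b ∘ₗ (Phi k).toLinearMap

/-- `b ⋆ α = m ∘ (b ⊗ α) ∘ Ψ`. -/
def actR (b : HCK k →ₗ[k] k) (α : H k →ₗ[k] k) : HCK k →ₗ[k] k :=
  LinearMap.mul' k k ∘ₗ TensorProduct.map b α ∘ₗ (Psi k).toLinearMap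

/-- The convolution product `b * c = m ∘ (b ⊗ c) ∘ Δ_CK`. -/
def conv (b c : HCK k →ₗ[k] k) : HCK k →ₗ[k] k :=
  LinearMap.mul' k k ∘ₗ TensorProduct.map b c ∘ₗ (coproductCK k).toLinearMap

variable (k)

/-- The element `δ_s` of the basis dual to the forest basis of `HCK`; a forest is given by the
multiplicities of its components. -/
def delta (s : RTree →₀ ℕ) : HCK k →ₗ[k] k := MvPolynomial.lcoeff k s

/-- The element `Z_s` of the basis dual to the forest basis of `H`. -/
def Z (s : {t : RTree // t ≠ RTree.dot} →₀ ℕ) : H k →ₗ[k] k := MvPolynomial.lcoeff k s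

/-- The co-unit `ε = δ_∅` of the Connes–Kreimer algebra. -/
def counitCK : HCK k →ₗ[k] k := delta k 0

/-- `δ_•`. -/
def deltaDot : HCK k →ₗ[k] k := delta k (Finsupp.single RTree.dot 1)

/-- `Z_•`, where `•` is the unit (empty product) of `H`. -/
def ZDot : H k →ₗ[k] k := Z k 0

variable {k}

/-- A linear form on `H` seen as a linear form on `HCK`: the one with the same value on each nonempty
tree, and zero on the empty forest and on the forests with two or more components. -/
def onTrees (α : H k →ₗ[k] k) : HCK k →ₗ[k] k :=
  (MvPolynomial.basisMonomials RTree k).constr k fun m =>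
    ∑ t ∈ m.support, if m = Finsupp.single t 1 then α (t.toH k) else 0

/-- `b'` is a two-sided inverse of `b` for the convolution product. -/
def IsConvInverse (b b' : HCK k →ₗ[k] k) : Prop :=
  conv b b' = counitCK k ∧ conv b' b = counitCK k

end TreeHopf

end

open TreeHopf

open scoped TensorProduct

noncomputable section

namespace TreeHopf

open scoped Classical

/-! ### Rooted forests as posets, and transport along isomorphisms -/

namespace Forest

/-! The three maps `coproductCK`, `Phi` and `Psi` are prescribed on trees only. Products of
components turn disjoint unions into products, and an invariant of forests with that property is
determined by its values on trees (`IsMultiplicative.ext`). This extends the formulas for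
`coproductCK` and `Phi` to all forests: a sum over upper sets of vertices (`coproductCK_toHCK`) and
a sum over sets of edges (`Phi_toHCK`).

For the unit statements, `Phi` and the flip of `Psi` satisfy the same axioms `IsCoaction`.
Contracting one tensor factor with the co-unit of `HCK` or with `Z_•` gives an algebra morphism, so
it is enough to look at trees, where `incl` has no component on the empty forest and the co-unit
laws of `coproduct` apply. Contracting with `δ_•`, the linear part at `•`, gives a derivation over
the co-unit, again determined by trees.

For a character `φ`, acting by `φ` is composition with the algebra endomorphism `twist φ = (φ ⊗ id)
∘ Φ`. Compatibility with `*` then says that `twist φ` respects `coproductCK`. On a tree this is the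
bijection of `sum_edges_crowns`: contracting a set of edges and then cutting is the same as cutting
first and contracting inside both parts. The cut never crosses a contracted edge, so the spanning
subforest splits as a disjoint union and `φ` takes the product of the two values. Inverses follow
because `φ` fixes the unit for `*` and `*` is associative. -/

theorem eq_of_verts_le {F G : Forest} (hv : F.verts = G.verts) (hl : F.le = G.le) : F = G := by
  cases F; cases G; cases hv; cases hl; rfl

theorem mem_roots {F : Forest} {r : ℕ} :
    r ∈ F.roots ↔ r ∈ F.verts ∧ ∀ x ∈ F.verts, F.le x r → x = r := by
  simp [roots]

theorem roots_subset (F : Forest) : F.roots ⊆ F.verts := Finset.filter_subset _ _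

@[simp] theorem restrict_verts (F : Forest) (A : Finset ℕ) :
    (F.restrict A).verts = F.verts ∩ A := rfl

@[simp] theorem spanning_verts (F : Forest) (S : Finset ℕ) : (F.spanning S).verts = F.verts := rfl

@[simp] theorem contract_verts (F : Forest) (S : Finset ℕ) :
    (F.contract S).verts = F.verts \ S := by
  ext; simp [contract]

theorem mem_above_verts {F : Forest} {r x : ℕ} :
    x ∈ (F.above r).verts ↔ x ∈ F.verts ∧ F.le r x := by
  simp [above]

theorem mem_edges {F : Forest} {x : ℕ} : x ∈ F.edges ↔ x ∈ F.verts ∧ x ∉ F.roots := by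
  simp [edges]

/-- The number of vertices below `x`. -/
def height (F : Forest) (x : ℕ) : ℕ := (F.verts.filter fun y => F.le y x).card

theorem height_lt (F : Forest) {x y : ℕ} (hx : x ∈ F.verts) (hy : y ∈ F.verts) (h : F.le x y)
    (hne : x ≠ y) : F.height x < F.height y := by
  refine Finset.card_lt_card (Finset.ssubset_iff_subset_ne.2 ⟨fun z hz => ?_, fun he => hne ?_⟩)
  · simp only [Finset.mem_filter] at hz ⊢
    exact ⟨hz.1, F.le_trans z hz.1 x hx y hy hz.2 h⟩
  · have : y ∈ F.verts.filter fun z => F.le z x := by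
      rw [he]; simp [hy, F.le_refl y hy]
    exact F.le_antisymm x hx y hy h (Finset.mem_filter.1 this).2

theorem exists_root_le (F : Forest) {x : ℕ} (hx : x ∈ F.verts) : ∃ r ∈ F.roots, F.le r x := by
  obtain ⟨r, hr, hmin⟩ := Finset.exists_min_image (F.verts.filter fun y => F.le y x) F.height
    ⟨x, by simp [hx, F.le_refl x hx]⟩
  simp only [Finset.mem_filter] at hr hmin
  refine ⟨r, mem_roots.2 ⟨hr.1, fun y hy hyr => ?_⟩, hr.2⟩
  by_contra hne
  have h1 := F.height_lt hy hr.1 hyr hne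
  have h2 := hmin y ⟨hy, F.le_trans y hy r hr.1 x hx hyr hr.2⟩
  omega

/-- A vertex of greatest height strictly below `x` has nothing strictly between it and `x`, so the
single edge ending at `x` joins the two in a spanning subforest. -/
theorem exists_parent (F : Forest) {x : ℕ} (hx : x ∈ F.edges) :
    ∃ p ∈ F.verts, F.le p x ∧ p ≠ x ∧
      ∀ z ∈ F.verts, F.le p z → z ≠ p → F.le z x → z = x := by
  rw [mem_edges, mem_roots] at hx
  obtain ⟨hx, hr⟩ := hx
  have : ∃ y ∈ F.verts, F.le y x ∧ y ≠ x := by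
    by_contra hcon
    push Not at hcon
    exact hr ⟨hx, hcon⟩
  obtain ⟨y, hy, hyx, hne⟩ := this
  obtain ⟨p, hp, hmax⟩ := Finset.exists_max_image
    (F.verts.filter fun y => F.le y x ∧ y ≠ x) F.height ⟨y, by simp [hy, hyx, hne]⟩
  simp only [Finset.mem_filter] at hp hmax
  refine ⟨p, hp.1, hp.2.1, hp.2.2, fun z hz hpz hzp hzx => ?_⟩
  by_contra hcon
  have h1 := F.height_lt hp.1 hz hpz (Ne.symm hzp)
  have h2 := hmax z ⟨hz, hzx, hcon⟩
  omega

/-- The map `f` on vertices is an isomorphism from `F` to `G`. -/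
structure IsoVia (f : ℕ → ℕ) (F G : Forest) : Prop where
  injOn : Set.InjOn f F.verts
  image : F.verts.image f = G.verts
  le_iff : ∀ x ∈ F.verts, ∀ y ∈ F.verts, (F.le x y ↔ G.le (f x) (f y))

theorem IsoVia.mem {f : ℕ → ℕ} {F G : Forest} (h : IsoVia f F G) {x : ℕ} (hx : x ∈ F.verts) :
    f x ∈ G.verts := h.image ▸ Finset.mem_image_of_mem f hx

theorem IsoVia.exists_eq {f : ℕ → ℕ} {F G : Forest} (h : IsoVia f F G) {y : ℕ}
    (hy : y ∈ G.verts) : ∃ x ∈ F.verts, f x = y := by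
  rw [← h.image] at hy; simpa using hy

theorem IsoVia.iso {f : ℕ → ℕ} {F G : Forest} (h : IsoVia f F G) : F.Iso G := by
  refine ⟨Equiv.ofBijective (fun x : F.verts => ⟨f x, h.mem x.2⟩) ⟨fun x y hxy => ?_, fun y => ?_⟩,
    fun x y => h.le_iff x x.2 y y.2⟩
  · exact Subtype.ext (h.injOn x.2 y.2 (congrArg Subtype.val hxy))
  · obtain ⟨x, hx, hxy⟩ := h.exists_eq y.2
    exact ⟨⟨x, hx⟩, Subtype.ext hxy⟩

/-- A map on all of `ℕ` allows vertex sets to be transported by `Finset.image`; its values off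
`F.verts` play no role. -/
theorem Iso.exists_isoVia {F G : Forest} (h : F.Iso G) : ∃ f, IsoVia f F G := by
  obtain ⟨e, he⟩ := h
  obtain ⟨f, hf⟩ : ∃ f : ℕ → ℕ, ∀ x (hx : x ∈ F.verts), f x = e ⟨x, hx⟩ :=
    ⟨fun x => if hx : x ∈ F.verts then e ⟨x, hx⟩ else 0, fun x hx => by simp [hx]⟩
  refine ⟨f, ?_, ?_, ?_⟩
  · intro x hx y hy hxy
    rw [hf x hx, hf y hy] at hxy
    exact congrArg Subtype.val (e.injective (Subtype.ext hxy))
  · ext y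
    rw [Finset.mem_image]
    constructor
    · rintro ⟨x, hx, rfl⟩
      rw [hf x hx]; exact (e _).2
    · intro hy
      refine ⟨e.symm ⟨y, hy⟩, (e.symm _).2, ?_⟩
      rw [hf _ (e.symm _).2]; simp
  · intro x hx y hy
    rw [hf x hx, hf y hy]
    exact he ⟨x, hx⟩ ⟨y, hy⟩

theorem isoVia_id {F G : Forest} (hv : F.verts = G.verts)
    (hl : ∀ x ∈ F.verts, ∀ y ∈ F.verts, (F.le x y ↔ G.le x y)) : IsoVia id F G :=
  ⟨Set.injOn_id _, by simpa using hv, hl⟩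

theorem IsoVia.mem_image {f : ℕ → ℕ} {F G : Forest} (h : IsoVia f F G) {A : Finset ℕ}
    (hA : A ⊆ F.verts) {x : ℕ} (hx : x ∈ F.verts) : f x ∈ A.image f ↔ x ∈ A := by
  refine ⟨fun hm => ?_, Finset.mem_image_of_mem f⟩
  obtain ⟨y, hy, hyx⟩ := Finset.mem_image.1 hm
  exact h.injOn (hA hy) hx hyx ▸ hy

theorem IsoVia.restrict {f : ℕ → ℕ} {F G : Forest} (h : IsoVia f F G) {A : Finset ℕ}
    (hA : A ⊆ F.verts) : IsoVia f (F.restrict A) (G.restrict (A.image f)) := by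
  have h1 : F.verts ∩ A = A := Finset.inter_eq_right.2 hA
  refine ⟨h.injOn.mono (by simp), ?_, fun x hx y hy => ?_⟩
  · simp only [restrict_verts, h1]
    rw [Finset.inter_eq_right.2]
    rw [← h.image]; exact Finset.image_subset_image hA
  · simp only [restrict_verts, h1] at hx hy
    exact h.le_iff x (hA hx) y (hA hy)

theorem IsoVia.image_sdiff {f : ℕ → ℕ} {F G : Forest} (h : IsoVia f F G) {A : Finset ℕ}
    (hA : A ⊆ F.verts) : (F.verts \ A).image f = G.verts \ A.image f := by
  rw [← h.image]
  exact Finset.image_sdiff_of_injOn h.injOn hA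

theorem IsoVia.contract {f : ℕ → ℕ} {F G : Forest} (h : IsoVia f F G) {A : Finset ℕ}
    (hA : A ⊆ F.verts) : IsoVia f (F.contract A) (G.contract (A.image f)) := by
  unfold Forest.contract
  rw [← h.image_sdiff hA]
  exact h.restrict Finset.sdiff_subset

theorem IsoVia.spanning {f : ℕ → ℕ} {F G : Forest} (h : IsoVia f F G) {S : Finset ℕ}
    (hS : S ⊆ F.verts) : IsoVia f (F.spanning S) (G.spanning (S.image f)) := by
  refine ⟨h.injOn, h.image, fun x hx y hy => ?_⟩
  simp only [spanning_verts] at hx hy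
  refine and_congr (h.le_iff x hx y hy) ⟨fun H z hz h1 h2 h3 => ?_, fun H z hz h1 h2 h3 => ?_⟩
  · obtain ⟨w, hw, rfl⟩ := h.exists_eq hz
    rw [h.mem_image hS hw]
    exact H w hw ((h.le_iff x hx w hw).2 h1) (fun he => h2 (he ▸ rfl)) ((h.le_iff w hw y hy).2 h3)
  · rw [← h.mem_image hS hz]
    exact H (f z) (h.mem hz) ((h.le_iff x hx z hz).1 h1) (fun he => h2 (h.injOn hz hx he))
      ((h.le_iff z hz y hy).1 h3)

theorem IsoVia.mem_roots {f : ℕ → ℕ} {F G : Forest} (h : IsoVia f F G) {x : ℕ}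
    (hx : x ∈ F.verts) : f x ∈ G.roots ↔ x ∈ F.roots := by
  simp only [Forest.mem_roots, hx, h.mem hx, true_and]
  refine ⟨fun H y hy hyx => h.injOn hy hx (H _ (h.mem hy) ((h.le_iff y hy x hx).1 hyx)),
    fun H y hy hyx => ?_⟩
  obtain ⟨w, hw, rfl⟩ := h.exists_eq hy
  rw [H w hw ((h.le_iff w hw x hx).2 hyx)]

theorem IsoVia.image_roots {f : ℕ → ℕ} {F G : Forest} (h : IsoVia f F G) :
    F.roots.image f = G.roots := by
  ext y
  rw [Finset.mem_image]
  refine ⟨?_, fun hy => ?_⟩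
  · rintro ⟨x, hx, rfl⟩
    exact (h.mem_roots (F.roots_subset hx)).2 hx
  · obtain ⟨x, hx, rfl⟩ := h.exists_eq (G.roots_subset hy)
    exact ⟨x, (h.mem_roots hx).1 hy, rfl⟩

theorem IsoVia.image_edges {f : ℕ → ℕ} {F G : Forest} (h : IsoVia f F G) :
    F.edges.image f = G.edges := by
  rw [edges, edges, h.image_sdiff F.roots_subset, h.image_roots]

theorem IsoVia.above {f : ℕ → ℕ} {F G : Forest} (h : IsoVia f F G) {r : ℕ} (hr : r ∈ F.verts) :
    IsoVia f (F.above r) (G.above (f r)) := by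
  have : G.above (f r) = G.restrict ((F.verts.filter fun x => F.le r x).image f) := by
    unfold Forest.above
    congr 1
    ext y
    simp only [Finset.mem_filter, Finset.mem_image]
    constructor
    · rintro ⟨hy, hry⟩
      obtain ⟨x, hx, rfl⟩ := h.exists_eq hy
      exact ⟨x, ⟨hx, (h.le_iff r hr x hx).2 hry⟩, rfl⟩
    · rintro ⟨x, ⟨hx, hrx⟩, rfl⟩
      exact ⟨h.mem hx, (h.le_iff r hr x hx).1 hrx⟩
  rw [this]
  exact h.restrict (Finset.filter_subset _ _)

/-- A set of vertices closed upwards. -/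
def IsUpper (F : Forest) (V : Finset ℕ) : Prop :=
  V ⊆ F.verts ∧ ∀ x ∈ V, ∀ y ∈ F.verts, F.le x y → y ∈ V

/-- A comparable pair in the wrong order, with the trunk element on top, is exactly a failure of
upward closure; antisymmetry excludes both orders at once. -/
theorem mem_crowns {F : Forest} {V : Finset ℕ} : V ∈ F.crowns ↔ F.IsUpper V := by
  simp only [crowns, Finset.mem_filter, Finset.mem_powerset, IsUpper]
  refine and_congr_right fun hV => ⟨fun H x hx y hy hxy => ?_, fun H x hx y hy hxy => ?_⟩
  · by_contra hyV
    have h := H y (by simp [hy, hyV]) x hx (Or.inr hxy)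
    exact h.2 (F.le_antisymm y hy x (hV hx) h.1 hxy)
  · obtain ⟨hx1, hx2⟩ := Finset.mem_sdiff.1 hx
    rcases hxy with h | h
    · exact ⟨h, fun he => hx2 (he ▸ hy)⟩
    · exact absurd (H y hy x hx1 h) hx2

theorem IsoVia.isUpper {f : ℕ → ℕ} {F G : Forest} (h : IsoVia f F G) {V : Finset ℕ}
    (hV : V ⊆ F.verts) : G.IsUpper (V.image f) ↔ F.IsUpper V := by
  refine and_congr ⟨fun _ => hV, fun _ => h.image ▸ Finset.image_subset_image hV⟩
    ⟨fun H x hx y hy hxy => ?_, fun H x hx y hy hxy => ?_⟩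
  · rw [← h.mem_image hV hy]
    exact H _ (Finset.mem_image_of_mem f hx) _ (h.mem hy) ((h.le_iff x (hV hx) y hy).1 hxy)
  · obtain ⟨w, hw, rfl⟩ := h.exists_eq hy
    obtain ⟨v, hv, rfl⟩ := Finset.mem_image.1 hx
    exact Finset.mem_image_of_mem f (H v hv w hw ((h.le_iff v (hV hv) w hw).2 hxy))

theorem sum_image_crowns {M : Type*} [AddCommMonoid M] {f : ℕ → ℕ} {F G : Forest}
    (h : IsoVia f F G) (g : Finset ℕ → M) :
    ∑ V ∈ F.crowns, g (V.image f) = ∑ V ∈ G.crowns, g V := by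
  refine Finset.sum_bij (fun V _ => V.image f) (fun V hV => ?_) (fun V hV W hW hVW => ?_)
    (fun V hV => ?_) (fun _ _ => rfl)
  · rw [mem_crowns] at *
    exact (h.isUpper hV.1).2 hV
  · rw [mem_crowns] at *
    ext x
    refine ⟨fun hx => ?_, fun hx => ?_⟩
    · rw [← h.mem_image hW.1 (hV.1 hx), ← hVW]; exact Finset.mem_image_of_mem f hx
    · rw [← h.mem_image hV.1 (hW.1 hx), hVW]; exact Finset.mem_image_of_mem f hx
  · rw [mem_crowns] at hV
    have hs := hV.1
    rw [← h.image] at hs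
    obtain ⟨W, hW, rfl⟩ := Finset.subset_image_iff.1 hs
    exact ⟨W, mem_crowns.2 ((h.isUpper (by exact_mod_cast hW)).1 hV), rfl⟩

theorem sum_image_powerset_edges {M : Type*} [AddCommMonoid M] {f : ℕ → ℕ} {F G : Forest}
    (h : IsoVia f F G) (g : Finset ℕ → M) :
    ∑ S ∈ F.edges.powerset, g (S.image f) = ∑ S ∈ G.edges.powerset, g S := by
  have hE : F.edges ⊆ F.verts := Finset.sdiff_subset
  refine Finset.sum_bij (fun V _ => V.image f) (fun V hV => ?_) (fun V hV W hW hVW => ?_)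
    (fun V hV => ?_) (fun _ _ => rfl)
  · rw [Finset.mem_powerset] at *
    rw [← h.image_edges]; exact Finset.image_subset_image hV
  · rw [Finset.mem_powerset] at *
    ext x
    refine ⟨fun hx => ?_, fun hx => ?_⟩
    · rw [← h.mem_image (hW.trans hE) (hE (hV hx)), ← hVW]; exact Finset.mem_image_of_mem f hx
    · rw [← h.mem_image (hV.trans hE) (hE (hW hx)), hVW]; exact Finset.mem_image_of_mem f hx
  · rw [Finset.mem_powerset, ← h.image_edges] at hV
    obtain ⟨W, hW, rfl⟩ := Finset.subset_image_iff.1 hV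
    exact ⟨W, Finset.mem_powerset.2 (by exact_mod_cast hW), rfl⟩

end Forest

/-! ### Disjoint unions and multiplicative invariants -/

namespace Forest

theorem component_eq {F G : Forest} (r : F.roots) (s : G.roots)
    (h : (F.above r).Iso (G.above s)) : F.component r = G.component s :=
  Quotient.sound h

/-- The component of the root `r`, with a default value when `r` is not a root. -/
def componentAt (F : Forest) (r : ℕ) : RTree :=
  if h : r ∈ F.roots then F.component ⟨r, h⟩ else RTree.dot

theorem componentAt_eq {F G : Forest} {r s : ℕ} (hr : r ∈ F.roots) (hs : s ∈ G.roots)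
    (h : (F.above r).Iso (G.above s)) : F.componentAt r = G.componentAt s := by
  rw [componentAt, componentAt, dif_pos hr, dif_pos hs]
  exact component_eq _ _ h

theorem prod_component {M : Type*} [CommMonoid M] (F : Forest) (g : RTree → M) :
    ∏ r : F.roots, g (F.component r) = ∏ r ∈ F.roots, g (F.componentAt r) := by
  rw [← Finset.prod_coe_sort F.roots fun r => g (F.componentAt r)]
  refine Finset.prod_congr rfl fun r _ => ?_
  rw [componentAt, dif_pos r.2]

/-- `F` is the disjoint union of its subforests `G₁` and `G₂`. -/
structure IsUnion (F G₁ G₂ : Forest) : Prop where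
  verts : F.verts = G₁.verts ∪ G₂.verts
  disj : Disjoint G₁.verts G₂.verts
  le₁ : ∀ x ∈ G₁.verts, ∀ y ∈ G₁.verts, (F.le x y ↔ G₁.le x y)
  le₂ : ∀ x ∈ G₂.verts, ∀ y ∈ G₂.verts, (F.le x y ↔ G₂.le x y)
  sep₁ : ∀ x ∈ G₁.verts, ∀ y ∈ G₂.verts, ¬ F.le x y
  sep₂ : ∀ x ∈ G₁.verts, ∀ y ∈ G₂.verts, ¬ F.le y x

namespace IsUnion

variable {F G₁ G₂ : Forest}

theorem symm (h : IsUnion F G₁ G₂) : IsUnion F G₂ G₁ :=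
  ⟨by rw [h.verts, Finset.union_comm], h.disj.symm, h.le₂, h.le₁,
    fun x hx y hy => h.sep₂ y hy x hx, fun x hx y hy => h.sep₁ y hy x hx⟩

theorem subset₁ (h : IsUnion F G₁ G₂) : G₁.verts ⊆ F.verts := by
  rw [h.verts]; exact Finset.subset_union_left

theorem subset₂ (h : IsUnion F G₁ G₂) : G₂.verts ⊆ F.verts := h.symm.subset₁

theorem mem_or (h : IsUnion F G₁ G₂) {x : ℕ} (hx : x ∈ F.verts) :
    x ∈ G₁.verts ∨ x ∈ G₂.verts := by
  rw [h.verts] at hx; exact Finset.mem_union.1 hx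

theorem mem_of_le (h : IsUnion F G₁ G₂) {x y : ℕ} (hx : x ∈ G₁.verts) (hy : y ∈ F.verts)
    (hxy : F.le x y ∨ F.le y x) : y ∈ G₁.verts := by
  rcases h.mem_or hy with h' | h'
  · exact h'
  · rcases hxy with hxy | hxy
    · exact absurd hxy (h.sep₁ x hx y h')
    · exact absurd hxy (h.sep₂ x hx y h')

theorem mem_roots (h : IsUnion F G₁ G₂) {x : ℕ} (hx : x ∈ G₁.verts) :
    x ∈ F.roots ↔ x ∈ G₁.roots := by
  simp only [Forest.mem_roots, hx, h.subset₁ hx, true_and]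
  refine ⟨fun H y hy hyx => H y (h.subset₁ hy) ((h.le₁ y hy x hx).2 hyx), fun H y hy hyx => ?_⟩
  have hy' := h.mem_of_le hx hy (Or.inr hyx)
  exact H y hy' ((h.le₁ y hy' x hx).1 hyx)

theorem roots (h : IsUnion F G₁ G₂) : F.roots = G₁.roots ∪ G₂.roots := by
  ext x
  rw [Finset.mem_union]
  constructor
  · intro hx
    rcases h.mem_or (F.roots_subset hx) with h' | h'
    · exact Or.inl ((h.mem_roots h').1 hx)
    · exact Or.inr ((h.symm.mem_roots h').1 hx)
  · rintro (hx | hx)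
    · exact (h.mem_roots (G₁.roots_subset hx)).2 hx
    · exact (h.symm.mem_roots (G₂.roots_subset hx)).2 hx

theorem mem_edges (h : IsUnion F G₁ G₂) {x : ℕ} (hx : x ∈ G₁.verts) :
    x ∈ F.edges ↔ x ∈ G₁.edges := by
  simp only [Forest.mem_edges, hx, h.subset₁ hx, h.mem_roots hx]

theorem componentAt_eq (h : IsUnion F G₁ G₂) {r : ℕ} (hr : r ∈ G₁.roots) :
    F.componentAt r = G₁.componentAt r := by
  have hr' := G₁.roots_subset hr
  refine Forest.componentAt_eq ((h.mem_roots hr').2 hr) hr (isoVia_id ?_ ?_).iso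
  · ext x
    simp only [mem_above_verts]
    refine ⟨fun hx => ?_, fun hx => ⟨h.subset₁ hx.1, (h.le₁ r hr' x hx.1).2 hx.2⟩⟩
    have hx' := h.mem_of_le hr' hx.1 (Or.inl hx.2)
    exact ⟨hx', (h.le₁ r hr' x hx').1 hx.2⟩
  · intro x hx y hy
    rw [mem_above_verts] at hx hy
    exact h.le₁ x (h.mem_of_le hr' hx.1 (Or.inl hx.2)) y (h.mem_of_le hr' hy.1 (Or.inl hy.2))

theorem restrict (h : IsUnion F G₁ G₂) (A : Finset ℕ) :
    IsUnion (F.restrict A) (G₁.restrict A) (G₂.restrict A) where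
  verts := by simp [h.verts, Finset.union_inter_distrib_right]
  disj := h.disj.mono (by simp) (by simp)
  le₁ x hx y hy := h.le₁ x (Finset.mem_inter.1 hx).1 y (Finset.mem_inter.1 hy).1
  le₂ x hx y hy := h.le₂ x (Finset.mem_inter.1 hx).1 y (Finset.mem_inter.1 hy).1
  sep₁ x hx y hy := h.sep₁ x (Finset.mem_inter.1 hx).1 y (Finset.mem_inter.1 hy).1
  sep₂ x hx y hy := h.sep₂ x (Finset.mem_inter.1 hx).1 y (Finset.mem_inter.1 hy).1

end IsUnion

theorem isUnion_restrict {F : Forest} {A : Finset ℕ} (hA : A ⊆ F.verts)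
    (h : ∀ x ∈ F.verts, ∀ y ∈ F.verts, F.le x y → (x ∈ A ↔ y ∈ A)) :
    IsUnion F (F.restrict A) (F.restrict (F.verts \ A)) where
  verts := by ext x; have := @hA x; simp; tauto
  disj := Finset.disjoint_left.2 fun x hx hx' => by simp at hx hx'; tauto
  le₁ _ _ _ _ := Iff.rfl
  le₂ _ _ _ _ := Iff.rfl
  sep₁ x hx y hy hxy := by
    simp at hx hy; have := h x hx.1 y hy.1 hxy; tauto
  sep₂ x hx y hy hxy := by
    simp at hx hy; have := h y hy.1 x hx.1 hxy; tauto

/-- An invariant of forests that is multiplicative for disjoint unions. -/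
structure IsMultiplicative {M : Type*} [CommMonoid M] (Q : Forest → M) : Prop where
  map_iso : ∀ F G, F.Iso G → Q F = Q G
  map_empty : ∀ F : Forest, F.verts = ∅ → Q F = 1
  map_union : ∀ F G₁ G₂, IsUnion F G₁ G₂ → Q F = Q G₁ * Q G₂

theorem isMultiplicative_prod_component {M : Type*} [CommMonoid M] (g : RTree → M) :
    IsMultiplicative fun F => ∏ r : F.roots, g (F.component r) where
  map_iso F G h := by
    obtain ⟨f, hf⟩ := h.exists_isoVia
    simp only [prod_component]
    rw [← hf.image_roots, Finset.prod_image fun x hx y hy =>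
      hf.injOn (F.roots_subset hx) (F.roots_subset hy)]
    refine Finset.prod_congr rfl fun r hr => ?_
    have hr' := F.roots_subset hr
    rw [componentAt_eq hr ((hf.mem_roots hr').2 hr) (hf.above hr').iso]
  map_empty F hF := by
    have : F.roots = ∅ := Finset.subset_empty.1 (hF ▸ F.roots_subset)
    rw [prod_component, this, Finset.prod_empty]
  map_union F G₁ G₂ h := by
    simp only [prod_component]
    rw [h.roots, Finset.prod_union (h.disj.mono G₁.roots_subset G₂.roots_subset)]
    congr 1
    · exact Finset.prod_congr rfl fun r hr => by rw [h.componentAt_eq hr]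
    · exact Finset.prod_congr rfl fun r hr => by rw [h.symm.componentAt_eq hr]

theorem IsMultiplicative.comp {M N : Type*} [CommMonoid M] [CommMonoid N] {Q : Forest → M}
    (h : IsMultiplicative Q) (f : M →* N) : IsMultiplicative fun F => f (Q F) :=
  ⟨fun F G hFG => by rw [h.map_iso F G hFG], fun F hF => by rw [h.map_empty F hF, map_one],
    fun F G₁ G₂ hF => by rw [h.map_union F G₁ G₂ hF, map_mul]⟩

/-- A multiplicative invariant is determined by its values on trees. -/
theorem IsMultiplicative.ext {M : Type*} [CommMonoid M] {Q Q' : Forest → M}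
    (h : IsMultiplicative Q) (h' : IsMultiplicative Q') (ht : ∀ F, F.IsTree → Q F = Q' F)
    (F : Forest) : Q F = Q' F := by
  induction hn : F.verts.card using Nat.strong_induction_on generalizing F with
  | _ n ih =>
    rcases F.verts.eq_empty_or_nonempty with he | ⟨x, hx⟩
    · rw [h.map_empty F he, h'.map_empty F he]
    · obtain ⟨r, hr, -⟩ := F.exists_root_le hx
      have hrv := F.roots_subset hr
      have hrA : r ∈ F.verts.filter fun x => F.le r x := by simp [hrv, F.le_refl r hrv]
      -- The set above a root is a union of whole components: the chain condition and minimality of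
      -- `r` make it closed downwards as well as upwards.
      have hU := isUnion_restrict (F := F) (A := F.verts.filter fun x => F.le r x)
        (Finset.filter_subset _ _) (fun x hx y hy hxy => by
          simp only [Finset.mem_filter, hx, hy, true_and]
          refine ⟨fun hrx => F.le_trans r hrv x hx y hy hrx hxy, fun hry => ?_⟩
          rcases F.le_chain r hrv x hx y hy hry hxy with h | h
          · exact h
          · rw [(mem_roots.1 hr).2 x hx h]; exact F.le_refl r hrv)
      rw [h.map_union _ _ _ hU, h'.map_union _ _ _ hU, ht (F.restrict _) (F.above_isTree hr),
        ih _ ?_ _ rfl]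
      rw [← hn]
      refine Finset.card_lt_card (Finset.ssubset_iff_subset_ne.2 ⟨by simp, fun he => ?_⟩)
      have := he ▸ hrv
      simp [hrA] at this

theorem isUpper_empty (F : Forest) : F.IsUpper ∅ := ⟨by simp, by simp⟩

theorem IsUnion.isUpper {F G₁ G₂ : Forest} (h : IsUnion F G₁ G₂) {V₁ V₂ : Finset ℕ}
    (h₁ : G₁.IsUpper V₁) (h₂ : G₂.IsUpper V₂) : F.IsUpper (V₁ ∪ V₂) := by
  refine ⟨Finset.union_subset (h₁.1.trans h.subset₁) (h₂.1.trans h.subset₂),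
    fun x hx y hy hxy => ?_⟩
  rcases Finset.mem_union.1 hx with hx | hx
  · have hy' := h.mem_of_le (h₁.1 hx) hy (Or.inl hxy)
    exact Finset.mem_union_left _ (h₁.2 x hx y hy' ((h.le₁ x (h₁.1 hx) y hy').1 hxy))
  · have hy' := h.symm.mem_of_le (h₂.1 hx) hy (Or.inl hxy)
    exact Finset.mem_union_right _ (h₂.2 x hx y hy' ((h.le₂ x (h₂.1 hx) y hy').1 hxy))

theorem IsUnion.isUpper_inter {F G₁ G₂ : Forest} (h : IsUnion F G₁ G₂) {V : Finset ℕ}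
    (hV : F.IsUpper V) : G₁.IsUpper (V ∩ G₁.verts) := by
  refine ⟨Finset.inter_subset_right, fun x hx y hy hxy => ?_⟩
  rw [Finset.mem_inter] at hx ⊢
  exact ⟨hV.2 x hx.1 y (h.subset₁ hy) ((h.le₁ x hx.2 y hy).2 hxy), hy⟩

theorem union_inter_left {A B X Y : Finset ℕ} (hd : Disjoint X Y) (hA : A ⊆ X) (hB : B ⊆ Y) :
    (A ∪ B) ∩ X = A := by
  rw [Finset.union_inter_distrib_right, Finset.inter_eq_left.2 hA,
    Finset.disjoint_iff_inter_eq_empty.1 (hd.symm.mono_left hB), Finset.union_empty]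

theorem union_inter_right {A B X Y : Finset ℕ} (hd : Disjoint X Y) (hA : A ⊆ X) (hB : B ⊆ Y) :
    (A ∪ B) ∩ Y = B := by
  rw [Finset.union_comm]; exact union_inter_left hd.symm hB hA

theorem inter_union_inter {A X Y : Finset ℕ} (hA : A ⊆ X ∪ Y) : A ∩ X ∪ A ∩ Y = A := by
  rw [← Finset.inter_union_distrib_left, Finset.inter_eq_left.2 hA]

/-- The sum over the crowns of a forest of products of multiplicative invariants. -/
theorem IsMultiplicative.sum_crowns {M : Type*} [CommSemiring M] {Q R : Forest → M}
    (hQ : IsMultiplicative Q) (hR : IsMultiplicative R) :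
    IsMultiplicative fun F => ∑ V ∈ F.crowns, Q (F.restrict V) * R (F.restrict (F.verts \ V)) where
  map_iso F G h := by
    obtain ⟨f, hf⟩ := h.exists_isoVia
    rw [← sum_image_crowns hf]
    refine Finset.sum_congr rfl fun V hV => ?_
    rw [mem_crowns] at hV
    rw [hQ.map_iso _ _ (hf.restrict hV.1).iso, hR.map_iso _ _ (hf.restrict Finset.sdiff_subset).iso,
      hf.image_sdiff hV.1]
  map_empty F hF := by
    have : F.crowns = {∅} := by
      ext V
      rw [mem_crowns, Finset.mem_singleton]
      refine ⟨fun h => Finset.subset_empty.1 (hF ▸ h.1), ?_⟩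
      rintro rfl
      exact F.isUpper_empty
    rw [this, Finset.sum_singleton, hQ.map_empty _ (by simp), hR.map_empty _ (by simp [hF]), mul_one]
  map_union F G₁ G₂ h := by
    rw [Finset.sum_mul_sum, ← Finset.sum_product']
    refine Finset.sum_bij' (fun V _ => (V ∩ G₁.verts, V ∩ G₂.verts)) (fun p _ => p.1 ∪ p.2)
      (fun V hV => ?_) (fun p hp => ?_) (fun V hV => ?_) (fun p hp => ?_) (fun V hV => ?_)
    · rw [mem_crowns] at hV
      rw [Finset.mem_product, mem_crowns, mem_crowns]
      exact ⟨h.isUpper_inter hV, h.symm.isUpper_inter hV⟩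
    · rw [Finset.mem_product, mem_crowns, mem_crowns] at hp
      rw [mem_crowns]
      exact h.isUpper hp.1 hp.2
    · rw [mem_crowns] at hV
      exact inter_union_inter (h.verts ▸ hV.1)
    · rw [Finset.mem_product, mem_crowns, mem_crowns] at hp
      exact Prod.ext (union_inter_left h.disj hp.1.1 hp.2.1)
        (union_inter_right h.disj hp.1.1 hp.2.1)
    · rw [hQ.map_union _ _ _ (h.restrict V), hR.map_union _ _ _ (h.restrict (F.verts \ V))]
      have e₁ : G₁.restrict V = G₁.restrict (V ∩ G₁.verts) :=
        eq_of_verts_le (by ext; simp; tauto) rfl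
      have e₂ : G₂.restrict V = G₂.restrict (V ∩ G₂.verts) :=
        eq_of_verts_le (by ext; simp; tauto) rfl
      have e₃ : G₁.restrict (F.verts \ V) = G₁.restrict (G₁.verts \ (V ∩ G₁.verts)) :=
        eq_of_verts_le (by ext x; have : x ∈ G₁.verts → x ∈ F.verts := fun hx => h.subset₁ hx; simp; tauto) rfl
      have e₄ : G₂.restrict (F.verts \ V) = G₂.restrict (G₂.verts \ (V ∩ G₂.verts)) :=
        eq_of_verts_le (by ext x; have : x ∈ G₂.verts → x ∈ F.verts := fun hx => h.subset₂ hx; simp; tauto) rfl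
      simp only [← e₁, ← e₂, ← e₃, ← e₄]
      exact mul_mul_mul_comm _ _ _ _

/-- Only convexity of `G` between `x` and `y` is required (`hc`), which covers both disjoint unions
and the two sides of a cut. -/
theorem spanning_le_iff {F G : Forest} {S T : Finset ℕ} {x y : ℕ} (hG : G.verts ⊆ F.verts)
    (hle : ∀ x ∈ G.verts, ∀ y ∈ G.verts, (F.le x y ↔ G.le x y)) (hx : x ∈ G.verts)
    (hy : y ∈ G.verts) (hc : ∀ z ∈ F.verts, F.le x z → F.le z y → z ∈ G.verts)
    (hST : ∀ z ∈ G.verts, (z ∈ S ↔ z ∈ T)) :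
    (F.spanning S).le x y ↔ (G.spanning T).le x y := by
  refine and_congr (hle x hx y hy) ⟨fun H z hz h1 h2 h3 => ?_, fun H z hz h1 h2 h3 => ?_⟩
  · exact (hST z hz).1 (H z (hG hz) ((hle x hx z hz).2 h1) h2 ((hle z hz y hy).2 h3))
  · have hz' := hc z hz h1 h3
    exact (hST z hz').2 (H z hz' ((hle x hx z hz').1 h1) h2 ((hle z hz' y hy).1 h3))

theorem IsUnion.spanning {F G₁ G₂ : Forest} (h : IsUnion F G₁ G₂) (S : Finset ℕ) :
    IsUnion (F.spanning S) (G₁.spanning (S ∩ G₁.verts)) (G₂.spanning (S ∩ G₂.verts)) where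
  verts := h.verts
  disj := h.disj
  le₁ x hx y hy := spanning_le_iff h.subset₁ h.le₁ hx hy
    (fun z hz hxz _ => h.mem_of_le hx hz (Or.inl hxz)) (fun z hz => by simp [hz])
  le₂ x hx y hy := spanning_le_iff h.subset₂ h.le₂ hx hy
    (fun z hz hxz _ => h.symm.mem_of_le hx hz (Or.inl hxz)) (fun z hz => by simp [hz])
  sep₁ x hx y hy hxy := h.sep₁ x hx y hy hxy.1
  sep₂ x hx y hy hxy := h.sep₂ x hx y hy hxy.1

theorem IsUnion.contract {F G₁ G₂ : Forest} (h : IsUnion F G₁ G₂) (S : Finset ℕ) :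
    IsUnion (F.contract S) (G₁.contract (S ∩ G₁.verts)) (G₂.contract (S ∩ G₂.verts)) := by
  have e₁ : G₁.contract (S ∩ G₁.verts) = G₁.restrict (F.verts \ S) :=
    eq_of_verts_le (by ext x; have : x ∈ G₁.verts → x ∈ F.verts := fun hx => h.subset₁ hx; simp; tauto) rfl
  have e₂ : G₂.contract (S ∩ G₂.verts) = G₂.restrict (F.verts \ S) :=
    eq_of_verts_le (by ext x; have : x ∈ G₂.verts → x ∈ F.verts := fun hx => h.subset₂ hx; simp; tauto) rfl
  rw [e₁, e₂]
  exact h.restrict _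

/-- The sum over the sets of edges of a forest of products of multiplicative invariants. -/
theorem IsMultiplicative.sum_edges {M : Type*} [CommSemiring M] {Q R : Forest → M}
    (hQ : IsMultiplicative Q) (hR : IsMultiplicative R) :
    IsMultiplicative fun F => ∑ S ∈ F.edges.powerset, Q (F.spanning S) * R (F.contract S) where
  map_iso F G h := by
    obtain ⟨f, hf⟩ := h.exists_isoVia
    rw [← sum_image_powerset_edges hf]
    refine Finset.sum_congr rfl fun S hS => ?_
    have hS' : S ⊆ F.verts := (Finset.mem_powerset.1 hS).trans Finset.sdiff_subset
    rw [hQ.map_iso _ _ (hf.spanning hS').iso, hR.map_iso _ _ (hf.contract hS').iso]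
  map_empty F hF := by
    have : F.edges = ∅ := by simp [edges, hF]
    rw [this, Finset.powerset_empty, Finset.sum_singleton, hQ.map_empty _ (by simp [hF]),
      hR.map_empty _ (by simp [hF]), mul_one]
  map_union F G₁ G₂ h := by
    have s₁ : G₁.edges ⊆ G₁.verts := Finset.sdiff_subset
    have s₂ : G₂.edges ⊆ G₂.verts := Finset.sdiff_subset
    rw [Finset.sum_mul_sum, ← Finset.sum_product']
    refine Finset.sum_bij' (fun V _ => (V ∩ G₁.verts, V ∩ G₂.verts)) (fun p _ => p.1 ∪ p.2)
      (fun V hV => ?_) (fun p hp => ?_) (fun V hV => ?_) (fun p hp => ?_) (fun V hV => ?_)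
    · rw [Finset.mem_powerset] at hV
      rw [Finset.mem_product, Finset.mem_powerset, Finset.mem_powerset]
      refine ⟨fun x hx => ?_, fun x hx => ?_⟩ <;> rw [Finset.mem_inter] at hx
      · exact (h.mem_edges hx.2).1 (hV hx.1)
      · exact (h.symm.mem_edges hx.2).1 (hV hx.1)
    · rw [Finset.mem_product, Finset.mem_powerset, Finset.mem_powerset] at hp
      rw [Finset.mem_powerset]
      refine Finset.union_subset (fun x hx => ?_) (fun x hx => ?_)
      · exact (h.mem_edges (s₁ (hp.1 hx))).2 (hp.1 hx)
      · exact (h.symm.mem_edges (s₂ (hp.2 hx))).2 (hp.2 hx)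
    · exact inter_union_inter (h.verts ▸ (Finset.mem_powerset.1 hV).trans Finset.sdiff_subset)
    · rw [Finset.mem_product, Finset.mem_powerset, Finset.mem_powerset] at hp
      exact Prod.ext (union_inter_left h.disj (hp.1.trans s₁) (hp.2.trans s₂))
        (union_inter_right h.disj (hp.1.trans s₁) (hp.2.trans s₂))
    · rw [hQ.map_union _ _ _ (h.spanning V), hR.map_union _ _ _ (h.contract V)]
      exact mul_mul_mul_comm _ _ _ _

end Forest

/-! ### Iterated cuts, and cuts against contractions -/

namespace Forest

theorem restrict_restrict (F : Forest) {A B C : Finset ℕ} (h : F.verts ∩ A ∩ B = F.verts ∩ C) :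
    (F.restrict A).restrict B = F.restrict C :=
  eq_of_verts_le h rfl

theorem restrict_verts_of_subset {F : Forest} {A : Finset ℕ} (h : A ⊆ F.verts) :
    (F.restrict A).verts = A := Finset.inter_eq_right.2 h

/-- The two ways of cutting a forest into three layers agree. -/
theorem sum_crowns_crowns {M : Type*} [AddCommMonoid M] (F : Forest)
    (g : Forest → Forest → Forest → M) :
    ∑ V ∈ F.crowns, ∑ U ∈ (F.restrict V).crowns,
      g ((F.restrict V).restrict U) ((F.restrict V).restrict ((F.restrict V).verts \ U))
        (F.restrict (F.verts \ V)) =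
    ∑ V ∈ F.crowns, ∑ U ∈ (F.restrict (F.verts \ V)).crowns,
      g (F.restrict V) ((F.restrict (F.verts \ V)).restrict U)
        ((F.restrict (F.verts \ V)).restrict ((F.restrict (F.verts \ V)).verts \ U)) := by
  rw [Finset.sum_sigma', Finset.sum_sigma']
  -- Both sums run over nested upper sets `U ⊆ V` of `F`, with layers `U`, `V \ U` and the
  -- complement of `V`.
  refine Finset.sum_bij' (fun p _ => ⟨p.2, p.1 \ p.2⟩) (fun p _ => ⟨p.1 ∪ p.2, p.1⟩)
    (fun p hp => ?_) (fun p hp => ?_) (fun p hp => ?_) (fun p hp => ?_) (fun p hp => ?_)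
  all_goals
    obtain ⟨A, B⟩ := p
    simp only [Finset.mem_sigma, mem_crowns] at hp ⊢
    obtain ⟨hA, hB⟩ := hp
    have hB' := hB.1
  · rw [restrict_verts_of_subset hA.1] at hB'
    refine ⟨⟨hB'.trans hA.1, fun x hx y hy hxy => ?_⟩, fun x hx => ?_, fun x hx y hy hxy => ?_⟩
    · exact hB.2 x hx y (Finset.mem_inter.2 ⟨hy, hA.2 x (hB' hx) y hy hxy⟩) hxy
    · have := @hA.1 x
      simp at hx ⊢; tauto
    · simp at hx hy ⊢
      exact ⟨hA.2 x hx.1 y hy.1 hxy, hy.2⟩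
  · rw [restrict_verts_of_subset Finset.sdiff_subset] at hB'
    have hBF : B ⊆ F.verts := hB'.trans Finset.sdiff_subset
    refine ⟨⟨Finset.union_subset hA.1 hBF, fun x hx y hy hxy => ?_⟩, fun x hx => ?_,
      fun x hx y hy hxy => ?_⟩
    · rw [Finset.mem_union] at hx ⊢
      by_cases hyA : y ∈ A
      · exact Or.inl hyA
      · rcases hx with hx | hx
        · exact Or.inl (hA.2 x hx y hy hxy)
        · exact Or.inr (hB.2 x hx y (by simp [hy, hyA]) hxy)
    · simp [hx, hA.1 hx]
    · exact hA.2 x hx y (Finset.mem_inter.1 hy).1 hxy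
  · rw [restrict_verts_of_subset hA.1] at hB'
    simp [Finset.union_eq_right.2 hB']
  · rw [restrict_verts_of_subset Finset.sdiff_subset] at hB'
    have : Disjoint A B := Finset.disjoint_left.2 fun x hx hx' =>
      (Finset.mem_sdiff.1 (hB' hx')).2 hx
    simp [Finset.union_sdiff_cancel_left this]
  · rw [restrict_verts_of_subset hA.1] at hB' ⊢
    congr 1
    · exact restrict_restrict _ (by ext x; have := @hB' x; simp; tauto)
    · refine (restrict_restrict _ (C := A \ B) ?_).trans (restrict_restrict _ ?_).symm
      · ext x; simp
      · ext x; simp; tauto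
    · refine (restrict_restrict _ ?_).symm
      ext x; have := @hB' x; simp; tauto

/-- The vertices of `F` above some element of `V`. -/
def upClosure (F : Forest) (V : Finset ℕ) : Finset ℕ :=
  F.verts.filter fun z => ∃ y ∈ V, F.le y z

theorem mem_upClosure {F : Forest} {V : Finset ℕ} {z : ℕ} :
    z ∈ F.upClosure V ↔ z ∈ F.verts ∧ ∃ y ∈ V, F.le y z := by
  simp [upClosure]

theorem isUpper_upClosure {F : Forest} {V : Finset ℕ} (hV : V ⊆ F.verts) :
    F.IsUpper (F.upClosure V) := by
  refine ⟨Finset.filter_subset _ _, fun x hx y hy hxy => ?_⟩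
  rw [mem_upClosure] at *
  obtain ⟨hx, w, hw, hwx⟩ := hx
  exact ⟨hy, w, hw, F.le_trans w (hV hw) x hx y hy hwx hxy⟩

theorem subset_upClosure {F : Forest} {V : Finset ℕ} (hV : V ⊆ F.verts) : V ⊆ F.upClosure V :=
  fun x hx => mem_upClosure.2 ⟨hV hx, x, hx, F.le_refl x (hV hx)⟩

/-- Closing upwards in `F` adds only vertices in `S`, since `V` is already closed among the vertices
that survive the contraction. -/
theorem upClosure_sdiff {F : Forest} {S V : Finset ℕ} (hV : (F.contract S).IsUpper V) :
    F.upClosure V \ S = V := by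
  have hV1 := hV.1
  rw [contract_verts] at hV1
  ext x
  rw [Finset.mem_sdiff, mem_upClosure]
  constructor
  · rintro ⟨⟨hx, y, hy, hyx⟩, hxS⟩
    exact hV.2 y hy x (by simp [hx, hxS]) hyx
  · intro hx
    have := Finset.mem_sdiff.1 (hV1 hx)
    exact ⟨⟨this.1, x, hx, F.le_refl x this.1⟩, this.2⟩

/-- A minimal vertex of the closure lies above some element of `V`, hence equals it. When `V` avoids
`S`, no edge of `S` therefore enters the closure from below. -/
theorem mem_of_mem_roots_upClosure {F : Forest} {V : Finset ℕ} (hV : V ⊆ F.verts) {x : ℕ}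
    (hx : x ∈ (F.restrict (F.upClosure V)).roots) : x ∈ V := by
  rw [mem_roots, restrict_verts_of_subset (isUpper_upClosure hV).1] at hx
  obtain ⟨y, hy, hyx⟩ := (mem_upClosure.1 hx.1).2
  exact hx.2 y (subset_upClosure hV hy) hyx ▸ hy

/-- The minimal vertices of `V` are not upper ends of edges inside `V`, so they survive the removal
of `S` and generate `V` again. -/
theorem IsUpper.upClosure_sdiff_eq {F : Forest} {V S : Finset ℕ} (hV : F.IsUpper V)
    (hS : S ⊆ (F.restrict V).edges) : F.upClosure (V \ S) = V := by
  ext x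
  rw [mem_upClosure]
  constructor
  · rintro ⟨hx, y, hy, hyx⟩
    exact hV.2 y (Finset.mem_sdiff.1 hy).1 x hx hyx
  · intro hx
    have hxV : x ∈ (F.restrict V).verts := by simp [hx, hV.1 hx]
    obtain ⟨r, hr, hrx⟩ := (F.restrict V).exists_root_le hxV
    refine ⟨hV.1 hx, r, Finset.mem_sdiff.2 ⟨?_, fun hrS => ?_⟩, hrx⟩
    · exact (Finset.mem_inter.1 (roots_subset _ hr)).2
    · exact (mem_edges.1 (hS hrS)).2 hr

theorem edges_subset (F : Forest) : F.edges ⊆ F.verts := Finset.sdiff_subset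

theorem restrict_edges_subset (F : Forest) (A : Finset ℕ) : (F.restrict A).edges ⊆ F.edges := by
  intro x hx
  rw [mem_edges, mem_roots] at hx ⊢
  simp at hx ⊢
  refine ⟨hx.1.1, fun _ => ?_⟩
  obtain ⟨y, hy, -, hyx, hne⟩ := hx.2 hx.1.1 hx.1.2
  exact ⟨y, hy, hyx, hne⟩

theorem IsUpper.mem_edges_compl {F : Forest} {V : Finset ℕ} (hV : F.IsUpper V) {x : ℕ}
    (hx : x ∈ F.edges) (hxV : x ∉ V) : x ∈ (F.restrict (F.verts \ V)).edges := by
  rw [mem_edges, mem_roots] at hx ⊢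
  simp at hx ⊢
  refine ⟨⟨hx.1, hxV⟩, fun _ _ => ?_⟩
  obtain ⟨y, hy, hyx, hne⟩ := hx.2 hx.1
  exact ⟨y, hy, fun hyV => hxV (hV.2 y hyV x hx.1 hyx), hyx, hne⟩

/-- If no lowest vertex of the upper set `V` is the upper end of an edge in `S`, then no edge in `S`
links `V` and its complement. -/
theorem IsUpper.isUnion_spanning {F : Forest} {V S₁ S₂ : Finset ℕ} (hV : F.IsUpper V)
    (h₁ : S₁ ⊆ (F.restrict V).edges) (h₂ : S₂ ⊆ (F.restrict (F.verts \ V)).edges) :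
    IsUnion (F.spanning (S₁ ∪ S₂)) ((F.restrict V).spanning S₁)
      ((F.restrict (F.verts \ V)).spanning S₂) where
  verts := by ext x; have := @hV.1 x; simp; tauto
  disj := Finset.disjoint_left.2 fun x hx hx' => by simp at hx hx'; tauto
  le₁ x hx y hy := by
    have h₂' := h₂.trans (edges_subset _)
    refine spanning_le_iff (by simp) (fun _ _ _ _ => Iff.rfl) hx hy (fun z hz hxz _ => ?_)
      (fun z hz => ?_)
    · exact Finset.mem_inter.2 ⟨hz, hV.2 x (Finset.mem_inter.1 hx).2 z hz hxz⟩
    · have := @h₂' z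
      simp at hz this ⊢; tauto
  le₂ x hx y hy := by
    have h₁' := h₁.trans (edges_subset _)
    refine spanning_le_iff (by simp) (fun _ _ _ _ => Iff.rfl) hx hy (fun z hz _ hzy => ?_)
      (fun z hz => ?_)
    · simp at hy ⊢
      exact ⟨hz, fun hzV => hy.2 (hV.2 z hzV y hy.1 hzy)⟩
    · have := @h₁' z
      simp at hz this ⊢; tauto
  sep₁ x hx y hy hxy := by
    simp at hx hy
    exact hy.2 (hV.2 x hx.2 y hy.1 hxy.1)
  sep₂ x hx y hy hxy := by
    have h₂' := h₂.trans (edges_subset _)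
    -- A path from `y` outside `V` up to `x` in `V` passes through the minimal vertex `m` of `V`
    -- below `x`, and `m` lies in neither `S₁` nor `S₂`.
    obtain ⟨m, hm, hmx⟩ := (F.restrict V).exists_root_le hx
    have hmv := Finset.mem_inter.1 (roots_subset _ hm)
    simp at hx hy
    have hym : F.le y m := by
      rcases F.le_chain y hy.1 m hmv.1 x hx.1 hxy.1 hmx with h | h
      · exact h
      · exact absurd (hV.2 m hmv.2 y hy.1 h) hy.2
    have hmS := hxy.2 m hmv.1 hym (fun he => hy.2 (he ▸ hmv.2)) hmx
    rcases Finset.mem_union.1 hmS with h | h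
    · exact (mem_edges.1 (h₁ h)).2 hm
    · have := h₂' h
      simp at this
      exact this.2 hmv.2

/-- Contracting and then cutting amounts to cutting and then contracting both parts. -/
theorem sum_edges_crowns {R M : Type*} [CommSemiring R] [AddCommMonoid M] [Module R M]
    {q : Forest → R} (hq : IsMultiplicative q) (g : Forest → Forest → M) (F : Forest) :
    ∑ S ∈ F.edges.powerset, ∑ V ∈ (F.contract S).crowns, q (F.spanning S) •
      g ((F.contract S).restrict V) ((F.contract S).restrict ((F.contract S).verts \ V)) =
    ∑ V ∈ F.crowns, ∑ p ∈ (F.restrict V).edges.powerset ×ˢ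
        (F.restrict (F.verts \ V)).edges.powerset,
      (q ((F.restrict V).spanning p.1) * q ((F.restrict (F.verts \ V)).spanning p.2)) •
        g ((F.restrict V).contract p.1) ((F.restrict (F.verts \ V)).contract p.2) := by
  rw [Finset.sum_sigma', Finset.sum_sigma']
  symm
  -- A cut `V` of `F` leaves the vertices `V \ S₁` after contraction. Conversely, a cut of the
  -- contracted forest is lifted by its upward closure in `F`, which restores the contracted
  -- vertices above it, and `S` is split along this closure.
  refine Finset.sum_bij' (fun p _ => ⟨p.2.1 ∪ p.2.2, p.1 \ p.2.1⟩)
    (fun p _ => ⟨F.upClosure p.2, (p.1 ∩ F.upClosure p.2, p.1 \ F.upClosure p.2)⟩)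
    (fun p hp => ?_) (fun p hp => ?_) (fun p hp => ?_) (fun p hp => ?_) (fun p hp => ?_)
  · obtain ⟨V, S₁, S₂⟩ := p
    simp only [Finset.mem_sigma, Finset.mem_product, Finset.mem_powerset, mem_crowns] at hp ⊢
    obtain ⟨hV, h₁, h₂⟩ := hp
    have h₂' := h₂.trans (edges_subset _)
    refine ⟨Finset.union_subset (h₁.trans (restrict_edges_subset _ _))
      (h₂.trans (restrict_edges_subset _ _)), fun x hx => ?_, fun x hx y hy hxy => ?_⟩
    · have h3 := @hV.1 x
      have h4 := @h₂' x
      simp at hx h4 ⊢; tauto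
    · simp at hx hy ⊢
      exact ⟨hV.2 x hx.1 y hy.1 hxy, hy.2.1⟩
  · obtain ⟨S, V⟩ := p
    simp only [Finset.mem_sigma, Finset.mem_product, Finset.mem_powerset, mem_crowns] at hp ⊢
    obtain ⟨hS, hV⟩ := hp
    have hV1 := hV.1
    rw [contract_verts] at hV1
    have hVF := hV1.trans Finset.sdiff_subset
    have hU := isUpper_upClosure hVF
    refine ⟨hU, fun x hx => ?_, fun x hx => ?_⟩
    · rw [Finset.mem_inter] at hx
      refine mem_edges.2 ⟨by simp [hx.2, hU.1 hx.2], fun hr => ?_⟩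
      exact (Finset.mem_sdiff.1 (hV1 (mem_of_mem_roots_upClosure hVF hr))).2 hx.1
    · rw [Finset.mem_sdiff] at hx
      exact hU.mem_edges_compl (hS hx.1) hx.2
  · obtain ⟨V, S₁, S₂⟩ := p
    simp only [Finset.mem_sigma, Finset.mem_product, Finset.mem_powerset, mem_crowns] at hp ⊢
    obtain ⟨hV, h₁, h₂⟩ := hp
    have h₁' := h₁.trans (edges_subset _)
    have h₂' := h₂.trans (edges_subset _)
    rw [hV.upClosure_sdiff_eq h₁]
    refine Sigma.ext rfl (heq_of_eq (Prod.ext ?_ ?_))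
    · ext x
      have h3 := @h₁' x
      have h4 := @h₂' x
      simp at h3 h4 ⊢; tauto
    · ext x
      have h3 := @h₁' x
      have h4 := @h₂' x
      simp at h3 h4 ⊢; tauto
  · obtain ⟨S, V⟩ := p
    simp only [Finset.mem_sigma, Finset.mem_powerset, mem_crowns] at hp ⊢
    obtain ⟨hS, hV⟩ := hp
    refine Sigma.ext ?_ (heq_of_eq ?_)
    · ext x; simp; tauto
    · dsimp only
      rw [← upClosure_sdiff hV]
      ext x; simp [upClosure_sdiff hV]
  · obtain ⟨V, S₁, S₂⟩ := p
    simp only [Finset.mem_sigma, Finset.mem_product, Finset.mem_powerset, mem_crowns] at hp ⊢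
    obtain ⟨hV, h₁, h₂⟩ := hp
    have h₁' := h₁.trans (edges_subset _)
    have h₂' := h₂.trans (edges_subset _)
    -- Multiplicativity of `q` enters only here: no edge of `S₁ ∪ S₂` crosses the cut.
    rw [hq.map_union _ _ _ (hV.isUnion_spanning h₁ h₂)]
    congr 2
    · refine eq_of_verts_le ?_ rfl
      ext x
      have h3 := @hV.1 x
      have h4 := @h₂' x
      simp at h4 ⊢; tauto
    · refine eq_of_verts_le ?_ rfl
      ext x
      have h3 := @hV.1 x
      have h4 := @h₁' x
      simp at h4 ⊢; tauto

end Forest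

/-! ### Trees, the tree `•`, and the extreme sets of edges -/

/-- The isomorphism class of a tree. -/
def RTree.mk {F : Forest} (h : F.IsTree) : RTree := Quotient.mk treeSetoid ⟨F, h⟩

namespace Forest

theorem IsTree.roots_eq {F : Forest} {r : ℕ} (hr : r ∈ F.verts) (h : ∀ x ∈ F.verts, F.le r x) :
    F.roots = {r} := by
  ext x
  rw [mem_roots, Finset.mem_singleton]
  constructor
  · rintro ⟨hx, H⟩
    exact (H r hr (h x hx)).symm
  · rintro rfl
    exact ⟨hr, fun y hy hyx => F.le_antisymm y hy x hr hyx (h y hy)⟩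

theorem prod_component_of_isTree {M : Type*} [CommMonoid M] {F : Forest} (h : F.IsTree)
    (g : RTree → M) :
    ∏ r : F.roots, g (F.component r) = g (RTree.mk h) := by
  obtain ⟨r, hr, H⟩ := id h
  have hroots := IsTree.roots_eq hr H
  have hr' : r ∈ F.roots := by simp [hroots]
  rw [prod_component, hroots, Finset.prod_singleton, componentAt, dif_pos hr']
  refine congrArg g (Quotient.sound (IsoVia.iso (f := id) (isoVia_id ?_ fun _ _ _ _ => Iff.rfl)))
  ext x
  rw [mem_above_verts]
  exact ⟨fun hx => hx.1, fun hx => ⟨hx, H x hx⟩⟩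

theorem contract_isTree {F : Forest} (h : F.IsTree) {S : Finset ℕ} (hS : S ⊆ F.edges) :
    (F.contract S).IsTree := by
  obtain ⟨r, hr, H⟩ := h
  have hroots := IsTree.roots_eq hr H
  refine ⟨r, ?_, fun x hx => H x ?_⟩
  · rw [contract_verts, Finset.mem_sdiff]
    exact ⟨hr, fun hrS => (mem_edges.1 (hS hrS)).2 (by simp [hroots])⟩
  · rw [contract_verts, Finset.mem_sdiff] at hx
    exact hx.1

theorem mk_eq_dot_iff {F : Forest} (h : F.IsTree) :
    RTree.mk h = RTree.dot ↔ F.verts.card = 1 := by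
  constructor
  · intro he
    obtain ⟨e, -⟩ := Quotient.exact he
    have := Fintype.card_congr e
    simpa [point] using this
  · intro hc
    obtain ⟨r, hr⟩ := Finset.card_eq_one.1 hc
    refine Quotient.sound (IsoVia.iso (f := fun _ => 0) (G := point) ⟨?_, ?_, ?_⟩)
    · intro x hx y hy _
      simp [hr] at hx hy
      rw [hx, hy]
    · simp [hr, point]
    · intro x hx y hy
      have hx' := F.le_refl x hx
      simp only [hr, Finset.mem_singleton] at hx hy
      subst hx hy
      simp [point, hx']

theorem contract_empty (F : Forest) : F.contract ∅ = F :=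
  eq_of_verts_le (by simp) rfl

/-- A vertex strictly above another is not a root, so every path is allowed. This is stated as an
isomorphism because the two relations may differ off the vertex set. -/
theorem isoVia_spanning_edges (F : Forest) : IsoVia id (F.spanning F.edges) F := by
  refine isoVia_id rfl fun x hx y hy => ⟨fun h => h.1, fun h => ⟨h, fun z hz hxz hne _ => ?_⟩⟩
  exact mem_edges.2 ⟨hz, fun hr => hne ((mem_roots.1 hr).2 x hx hxz).symm⟩

theorem componentAt_eq_dot_iff {F : Forest} {r : ℕ} (hr : r ∈ F.roots) :
    F.componentAt r = RTree.dot ↔ (F.above r).verts = {r} := by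
  have hrv := F.roots_subset hr
  have hm : r ∈ (F.above r).verts := mem_above_verts.2 ⟨hrv, F.le_refl r hrv⟩
  rw [componentAt, dif_pos hr]
  refine (mk_eq_dot_iff (F.above_isTree hr)).trans ⟨fun h => ?_, fun h => by simp [h]⟩
  obtain ⟨s, hs⟩ := Finset.card_eq_one.1 h
  rw [hs, Finset.mem_singleton] at hm
  rw [hs, hm]

theorem componentAt_spanning_empty {F : Forest} {r : ℕ} (hr : r ∈ (F.spanning ∅).roots) :
    (F.spanning ∅).componentAt r = RTree.dot := by
  have hrv := roots_subset _ hr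
  rw [componentAt_eq_dot_iff hr]
  ext x
  rw [mem_above_verts, Finset.mem_singleton]
  constructor
  · rintro ⟨hx, hrx⟩
    by_contra hne
    simpa using hrx.2 x hx hrx.1 hne (F.le_refl x hx)
  · rintro rfl
    exact ⟨hrv, (F.spanning ∅).le_refl x hrv⟩

/-- The upper end of an edge in `S` and its parent share a component, which thus has two vertices.
-/
theorem exists_componentAt_ne_dot {F : Forest} {S : Finset ℕ} (hS : S ⊆ F.edges)
    (hne : S.Nonempty) : ∃ r ∈ (F.spanning S).roots, (F.spanning S).componentAt r ≠ RTree.dot := by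
  obtain ⟨s, hs⟩ := hne
  obtain ⟨p, hp, hps, hpne, H⟩ := F.exists_parent (hS hs)
  have hsv := F.edges_subset (hS hs)
  have hps' : (F.spanning S).le p s :=
    ⟨hps, fun z hz h1 h2 h3 => (H z hz h1 h2 h3).symm ▸ hs⟩
  obtain ⟨m, hm, hmp⟩ := (F.spanning S).exists_root_le hp
  have hmv := roots_subset _ hm
  refine ⟨m, hm, fun hd => ?_⟩
  rw [componentAt_eq_dot_iff hm] at hd
  have h1 : p ∈ ((F.spanning S).above m).verts := mem_above_verts.2 ⟨hp, hmp⟩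
  have h2 : s ∈ ((F.spanning S).above m).verts :=
    mem_above_verts.2 ⟨hsv, (F.spanning S).le_trans m hmv p hp s hsv hmp hps'⟩
  rw [hd, Finset.mem_singleton] at h1 h2
  exact hpne (h1.trans h2.symm)

end Forest

namespace RTree

theorem rep_isTree (t : RTree) : t.rep.IsTree := (Quotient.out t).2

theorem mk_rep (t : RTree) : RTree.mk t.rep_isTree = t :=
  Quotient.out_eq t

theorem rep_mk_iso {F : Forest} (h : F.IsTree) :
    (rep (RTree.mk h)).Iso F :=
  Quotient.mk_out (s := treeSetoid) ⟨F, h⟩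

end RTree

/-! ### Augmentations, the embedding `incl`, and the coproducts on forests -/

variable (k : Type*) [Field k]

theorem toHCK_of_isTree {F : Forest} (h : F.IsTree) :
    F.toHCK k = MvPolynomial.X (RTree.mk h) :=
  Forest.prod_component_of_isTree h _

theorem toH_of_isTree {F : Forest} (h : F.IsTree) :
    F.toH k = RTree.toH k (RTree.mk h) :=
  Forest.prod_component_of_isTree h _

theorem toHCK_rep (t : RTree) : t.rep.toHCK k = MvPolynomial.X t := by
  rw [toHCK_of_isTree k t.rep_isTree, t.mk_rep]

theorem toH_rep (t : RTree) : t.rep.toH k = t.toH k := by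
  rw [toH_of_isTree k t.rep_isTree, t.mk_rep]

theorem isMultiplicative_toHCK : Forest.IsMultiplicative (Forest.toHCK k) :=
  Forest.isMultiplicative_prod_component _

theorem isMultiplicative_toH : Forest.IsMultiplicative (Forest.toH k) :=
  Forest.isMultiplicative_prod_component _

theorem toH_dot : RTree.dot.toH k = 1 := by simp [RTree.toH]

theorem toH_spanning_empty (F : Forest) : (F.spanning ∅).toH k = 1 := by
  rw [Forest.toH, Forest.prod_component (g := RTree.toH k)]
  refine Finset.prod_eq_one fun r hr => ?_
  rw [Forest.componentAt_spanning_empty hr, toH_dot]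

theorem toH_spanning_edges (F : Forest) : (F.spanning F.edges).toH k = F.toH k :=
  (isMultiplicative_toH k).map_iso _ _ F.isoVia_spanning_edges.iso

/-- The augmentation of `H`, as an algebra morphism. -/
def augH : H k →ₐ[k] k := MvPolynomial.aeval fun _ => 0

/-- The co-unit of `HCK`, as an algebra morphism. -/
def augCK : HCK k →ₐ[k] k := MvPolynomial.aeval fun _ => 0

theorem augH_toLinearMap : (augH k).toLinearMap = ZDot k := by
  ext p
  simp only [augH, ZDot, Z, AlgHom.toLinearMap_apply, LinearMap.coe_comp, Function.comp_apply,
    MvPolynomial.lcoeff_apply, MvPolynomial.aeval_zero']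
  simp [MvPolynomial.constantCoeff_eq]

theorem augCK_toLinearMap : (augCK k).toLinearMap = counitCK k := by
  ext p
  simp only [augCK, counitCK, delta, AlgHom.toLinearMap_apply, LinearMap.coe_comp,
    Function.comp_apply, MvPolynomial.lcoeff_apply, MvPolynomial.aeval_zero']
  simp [MvPolynomial.constantCoeff_eq]

theorem ZDot_apply (p : H k) : ZDot k p = augH k p := by rw [← augH_toLinearMap]; rfl

theorem counitCK_apply (p : HCK k) : counitCK k p = augCK k p := by rw [← augCK_toLinearMap]; rfl

theorem augH_toH (t : RTree) : augH k (t.toH k) = if t = RTree.dot then 1 else 0 := by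
  unfold RTree.toH
  split_ifs <;> simp [augH]

/-- A nonempty `S` produces a component other than `•`, and the augmentation kills that factor. -/
theorem augH_spanning {F : Forest} {S : Finset ℕ} (hS : S ⊆ F.edges) :
    augH k ((F.spanning S).toH k) = if S = ∅ then 1 else 0 := by
  split_ifs with h
  · rw [h, toH_spanning_empty, map_one]
  · obtain ⟨r, hr, hd⟩ :=
      Forest.exists_componentAt_ne_dot hS (Finset.nonempty_iff_ne_empty.2 h)
    rw [Forest.toH, Forest.prod_component (g := RTree.toH k), map_prod]
    exact Finset.prod_eq_zero hr (by rw [augH_toH, if_neg hd])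

/-- The contracted forest is a tree, and it is `•` only when the root alone survives. -/
theorem augH_contract {F : Forest} (hF : F.IsTree) {S : Finset ℕ} (hS : S ⊆ F.edges) :
    augH k ((F.contract S).toH k) = if S = F.edges then 1 else 0 := by
  rw [toH_of_isTree k (Forest.contract_isTree hF hS), augH_toH]
  refine if_congr ((Forest.mk_eq_dot_iff _).trans ?_) rfl rfl
  obtain ⟨r, hr, H⟩ := hF
  have hroots := Forest.IsTree.roots_eq hr H
  rw [Forest.contract_verts]
  have hrS : r ∉ S := fun h => (Forest.mem_edges.1 (hS h)).2 (by simp [hroots])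
  constructor
  · intro hc
    obtain ⟨s, hs⟩ := Finset.card_eq_one.1 hc
    have hrs : r ∈ F.verts \ S := by simp [hr, hrS]
    rw [hs, Finset.mem_singleton] at hrs
    subst hrs
    refine Finset.Subset.antisymm hS fun x hx => ?_
    rw [Forest.mem_edges, hroots, Finset.mem_singleton] at hx
    by_contra hxS
    have : x ∈ F.verts \ S := by simp [hx.1, hxS]
    rw [hs, Finset.mem_singleton] at this
    exact hx.2 this
  · rintro rfl
    rw [Forest.edges, Finset.sdiff_sdiff_eq_self F.roots_subset, hroots, Finset.card_singleton]

/-- The generators of `H` leave out `•`; that case agrees because `•` has no edges and the sum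
reduces to `1 ⊗ 1`. -/
theorem coproduct_toH (t : RTree) :
    coproduct k (t.toH k) = ∑ S ∈ t.rep.edges.powerset,
      (t.rep.spanning S).toH k ⊗ₜ[k] (t.rep.contract S).toH k := by
  by_cases h : t = RTree.dot
  · have hc : t.rep.verts.card = 1 := by
      rw [← Forest.mk_eq_dot_iff t.rep_isTree, t.mk_rep, h]
    have he : t.rep.edges = ∅ := by
      obtain ⟨r, hr, H⟩ := t.rep_isTree
      obtain ⟨s, hs⟩ := Finset.card_eq_one.1 hc
      rw [Forest.edges, Forest.IsTree.roots_eq hr H, hs]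
      rw [hs, Finset.mem_singleton] at hr
      simp [hr]
    rw [he, Finset.powerset_empty, Finset.sum_singleton, toH_spanning_empty,
      Forest.contract_empty, toH_rep, h, toH_dot, map_one]
    rfl
  · rw [RTree.toH, dif_neg h, coproduct, MvPolynomial.aeval_X]

theorem incl_one : incl k 1 = MvPolynomial.X RTree.dot := by
  have : (1 : H k) = MvPolynomial.basisMonomials _ k 0 := by simp
  rw [this, incl, Module.Basis.constr_basis, if_pos rfl]

theorem incl_monomial {m : {t : RTree // t ≠ RTree.dot} →₀ ℕ} (hm : m ≠ 0) :
    incl k (MvPolynomial.monomial m 1) =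
      MvPolynomial.rename Subtype.val (MvPolynomial.monomial m (1 : k)) := by
  have : MvPolynomial.monomial m (1 : k) = MvPolynomial.basisMonomials _ k m := by simp
  rw [this, incl, Module.Basis.constr_basis, if_neg hm, this]

theorem incl_toH (t : RTree) : incl k (t.toH k) = MvPolynomial.X t := by
  by_cases h : t = RTree.dot
  · rw [h, toH_dot, incl_one]
  · rw [RTree.toH, dif_neg h, MvPolynomial.X, incl_monomial k (by simp), ← MvPolynomial.X,
      MvPolynomial.rename_X]

theorem incl_toH_of_isTree {F : Forest} (h : F.IsTree) : incl k (F.toH k) = F.toHCK k := by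
  rw [toH_of_isTree k h, incl_toH, toHCK_of_isTree k h]

/-- The unit goes to the tree `•`, and renaming along an injection keeps nonzero exponents nonzero,
so the empty forest never occurs. -/
theorem counitCK_comp_incl : counitCK k ∘ₗ incl k = 0 := by
  refine (MvPolynomial.basisMonomials _ k).ext fun m => ?_
  rw [MvPolynomial.coe_basisMonomials, LinearMap.comp_apply, LinearMap.zero_apply]
  beta_reduce
  by_cases hm : m = 0
  · subst hm
    rw [show (MvPolynomial.monomial 0 (1 : k) : H k) = 1 from rfl, incl_one, counitCK_apply]
    simp [augCK]
  · rw [incl_monomial k hm, MvPolynomial.rename_monomial, counitCK, delta,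
      MvPolynomial.lcoeff_apply, MvPolynomial.coeff_monomial, if_neg]
    intro h
    exact hm (Finsupp.mapDomain_injective Subtype.val_injective (h.trans Finsupp.mapDomain_zero.symm))

/-- Renamed monomials do not involve `•`, so only the unit of `H` contributes. -/
theorem deltaDot_comp_incl : deltaDot k ∘ₗ incl k = ZDot k := by
  refine (MvPolynomial.basisMonomials _ k).ext fun m => ?_
  rw [MvPolynomial.coe_basisMonomials, LinearMap.comp_apply]
  beta_reduce
  by_cases hm : m = 0
  · subst hm
    rw [ZDot_apply, show (MvPolynomial.monomial 0 (1 : k) : H k) = 1 from rfl, incl_one, map_one,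
      deltaDot, delta, MvPolynomial.lcoeff_apply, MvPolynomial.coeff_X, if_pos rfl]
  · rw [incl_monomial k hm, MvPolynomial.rename_monomial, deltaDot, delta, ZDot, Z,
      MvPolynomial.lcoeff_apply, MvPolynomial.coeff_monomial, MvPolynomial.lcoeff_apply,
      MvPolynomial.coeff_monomial, if_neg hm, if_neg]
    intro h
    have h1 := DFunLike.congr_fun h RTree.dot
    rw [Finsupp.mapDomain_of_notMem_range _ _ (by simp)] at h1
    simp at h1

/-- Both sides are multiplicative in `F`, so trees suffice; there `map_iso` passes between `F` and
the representative used in the definition. -/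
theorem coproductCK_toHCK (F : Forest) :
    coproductCK k (F.toHCK k) = ∑ V ∈ F.crowns,
      (F.restrict V).toHCK k ⊗ₜ[k] (F.restrict (F.verts \ V)).toHCK k := by
  have hQ := (isMultiplicative_toHCK k).comp ((coproductCK k : HCK k →* HCK k ⊗[k] HCK k))
  have hR := ((isMultiplicative_toHCK k).comp
    ((Algebra.TensorProduct.includeLeft : HCK k →ₐ[k] HCK k ⊗[k] HCK k) :
      HCK k →* HCK k ⊗[k] HCK k)).sum_crowns ((isMultiplicative_toHCK k).comp
    ((Algebra.TensorProduct.includeRight : HCK k →ₐ[k] HCK k ⊗[k] HCK k) :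
      HCK k →* HCK k ⊗[k] HCK k))
  have key := hQ.ext hR (fun F hF => ?_) F
  · simpa using key
  · rw [← hR.map_iso _ _ (RTree.rep_mk_iso hF)]
    simp [toHCK_of_isTree k hF, coproductCK]

theorem Phi_X (t : RTree) :
    Phi k (MvPolynomial.X t) = (incl k).lTensor (H k) (coproduct k (t.toH k)) := by
  rw [Phi, MvPolynomial.aeval_X]

theorem Psi_X (t : RTree) :
    Psi k (MvPolynomial.X t) = (incl k).rTensor (H k) (coproduct k (t.toH k)) := by
  rw [Psi, MvPolynomial.aeval_X]

/-- Multiplicativity reduces this to trees, where each contraction is again a tree and `incl` turns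
its `toH` into its `toHCK`. -/
theorem Phi_toHCK (F : Forest) :
    Phi k (F.toHCK k) = ∑ S ∈ F.edges.powerset,
      (F.spanning S).toH k ⊗ₜ[k] (F.contract S).toHCK k := by
  have hQ := (isMultiplicative_toHCK k).comp ((Phi k : HCK k →* H k ⊗[k] HCK k))
  have hR := ((isMultiplicative_toH k).comp
    ((Algebra.TensorProduct.includeLeft : H k →ₐ[k] H k ⊗[k] HCK k) :
      H k →* H k ⊗[k] HCK k)).sum_edges ((isMultiplicative_toHCK k).comp
    ((Algebra.TensorProduct.includeRight : HCK k →ₐ[k] H k ⊗[k] HCK k) :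
      HCK k →* H k ⊗[k] HCK k))
  have key := hQ.ext hR (fun F hF => ?_) F
  · simpa using key
  · rw [← hR.map_iso _ _ (RTree.rep_mk_iso hF)]
    rw [toHCK_of_isTree k hF]
    simp only [MonoidHom.coe_coe, Phi_X, coproduct_toH, map_sum, LinearMap.lTensor_tmul,
      Algebra.TensorProduct.includeLeft_apply, Algebra.TensorProduct.includeRight_apply,
      Algebra.TensorProduct.tmul_mul_tmul, mul_one, one_mul]
    refine Finset.sum_congr rfl fun S hS => ?_
    rw [incl_toH_of_isTree k
      (Forest.contract_isTree (RTree.rep_isTree _) (Finset.mem_powerset.1 hS))]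

/-- The co-unit law on the left factor. -/
theorem lid_ZDot_coproduct (t : RTree) :
    TensorProduct.lid k (H k) ((ZDot k).rTensor (H k) (coproduct k (t.toH k))) = t.toH k := by
  simp only [coproduct_toH, map_sum, LinearMap.rTensor_tmul, TensorProduct.lid_tmul, ZDot_apply]
  rw [Finset.sum_eq_single ∅]
  · rw [augH_spanning k (Finset.empty_subset _), if_pos rfl, one_smul, Forest.contract_empty,
      toH_rep]
  · intro S hS hne
    rw [augH_spanning k (Finset.mem_powerset.1 hS), if_neg hne, zero_smul]
  · simp

/-- The co-unit law on the right factor. -/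
theorem rid_ZDot_coproduct (t : RTree) :
    TensorProduct.rid k (H k) ((ZDot k).lTensor (H k) (coproduct k (t.toH k))) = t.toH k := by
  simp only [coproduct_toH, map_sum, LinearMap.lTensor_tmul, TensorProduct.rid_tmul, ZDot_apply]
  rw [Finset.sum_eq_single t.rep.edges]
  · rw [augH_contract k t.rep_isTree (Finset.Subset.refl _), if_pos rfl, one_smul,
      toH_spanning_edges, toH_rep]
  · intro S hS hne
    rw [augH_contract k t.rep_isTree (Finset.mem_powerset.1 hS), if_neg hne, zero_smul]
  · simp

theorem onTrees_one (α : H k →ₗ[k] k) : onTrees α (1 : HCK k) = 0 := by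
  have : (1 : HCK k) = MvPolynomial.basisMonomials _ k 0 := by simp
  rw [this, onTrees, Module.Basis.constr_basis]
  simp

theorem augCK_monomial (m : RTree →₀ ℕ) :
    augCK k (MvPolynomial.monomial m 1) = if m = 0 then 1 else 0 := by
  rw [← counitCK_apply, counitCK, delta, MvPolynomial.lcoeff_apply, MvPolynomial.coeff_monomial]

theorem add_single_eq_single {m : RTree →₀ ℕ} {s t : RTree}
    (h : m + Finsupp.single s 1 = Finsupp.single t 1) : m = 0 ∧ s = t := by
  have hs := DFunLike.congr_fun h s
  have hst : s = t := by
    by_contra hne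
    simp [Finsupp.single_eq_of_ne hne] at hs
  subst hst
  exact ⟨by simpa using h, rfl⟩

/-- A product with the factor `t` is a single tree only if the other factor is constant. -/
theorem onTrees_mul_X (α : H k →ₗ[k] k) (p : HCK k) (t : RTree) :
    onTrees α (p * MvPolynomial.X t) = augCK k p * α (t.toH k) := by
  induction p using MvPolynomial.induction_on' with
  | add p q hp hq => rw [add_mul, map_add, hp, hq, map_add, add_mul]
  | monomial m a =>
    have h1 : MvPolynomial.monomial m a = a • MvPolynomial.monomial m (1 : k) := by
      rw [MvPolynomial.smul_monomial, smul_eq_mul, mul_one]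
    have h2 : MvPolynomial.monomial m (1 : k) * MvPolynomial.X t =
        MvPolynomial.basisMonomials _ k (m + Finsupp.single t 1) := by
      rw [MvPolynomial.X, MvPolynomial.monomial_mul, mul_one, MvPolynomial.coe_basisMonomials]
    rw [h1, smul_mul_assoc, map_smul, map_smul, h2, onTrees, Module.Basis.constr_basis,
      augCK_monomial, smul_mul_assoc]
    congr 1
    by_cases hm : m = 0
    · subst hm
      rw [zero_add, Finsupp.support_single t one_ne_zero, Finset.sum_singleton,
        if_pos rfl, if_pos rfl, one_mul]
    · rw [if_neg hm, zero_mul]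
      exact Finset.sum_eq_zero fun s _ => if_neg fun h => hm (add_single_eq_single h).1

/-- The exponent of `•` splits in just two ways, so `δ_•` is a derivation over the co-unit. -/
theorem deltaDot_mul (p q : HCK k) :
    deltaDot k (p * q) = augCK k p * deltaDot k q + deltaDot k p * augCK k q := by
  rw [← counitCK_apply, ← counitCK_apply]
  simp only [deltaDot, counitCK, delta, MvPolynomial.lcoeff_apply]
  rw [MvPolynomial.coeff_mul, Finsupp.antidiagonal_single, Finset.sum_map,
    Finset.Nat.antidiagonal_succ]
  simp

/-! ### Unit laws, for both coactions at once -/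

section Coaction

variable {k}

/-- Contracting with `b` first leaves an element of `A` that does not depend on `α`. With `A = H`,
it can be computed multiplicatively before the merely linear `α` is applied. -/
theorem mul'_map_eq_rid {A B : Type*} [AddCommGroup A] [Module k A] [AddCommGroup B] [Module k B]
    (α : A →ₗ[k] k) (b : B →ₗ[k] k) (z : A ⊗[k] B) :
    LinearMap.mul' k k (TensorProduct.map α b z) = α (TensorProduct.rid k A (b.lTensor A z)) := by
  induction z with
  | zero => simp
  | add x y hx hy => simp only [map_add, hx, hy]
  | tmul x y => simp [mul_comm]

theorem mul'_map_eq_lid {A B : Type*} [AddCommGroup A] [Module k A] [AddCommGroup B] [Module k B]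
    (α : A →ₗ[k] k) (b : B →ₗ[k] k) (z : A ⊗[k] B) :
    LinearMap.mul' k k (TensorProduct.map α b z) = b (TensorProduct.lid k B (α.rTensor B z)) := by
  induction z with
  | zero => simp
  | add x y hx hy => simp only [map_add, hx, hy]
  | tmul x y => simp

theorem mul'_map_comm {A B : Type*} [AddCommGroup A] [Module k A] [AddCommGroup B] [Module k B]
    (α : A →ₗ[k] k) (b : B →ₗ[k] k) (z : B ⊗[k] A) :
    LinearMap.mul' k k (TensorProduct.map b α z) =
      LinearMap.mul' k k (TensorProduct.map α b (TensorProduct.comm k B A z)) := by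
  induction z with
  | zero => simp
  | add x y hx hy => simp only [map_add, hx, hy]
  | tmul x y => simp [mul_comm]

/-- An algebra morphism `HCK → H ⊗ HCK` given on trees by elements `d t` of `H ⊗ H` that satisfy the
co-unit laws. -/
structure IsCoaction (Θ : HCK k →ₐ[k] H k ⊗[k] HCK k) (d : RTree → H k ⊗[k] H k) : Prop where
  map_X : ∀ t, Θ (MvPolynomial.X t) = (incl k).lTensor (H k) (d t)
  lid_ZDot : ∀ t, TensorProduct.lid k (H k) ((ZDot k).rTensor (H k) (d t)) = t.toH k
  rid_ZDot : ∀ t, TensorProduct.rid k (H k) ((ZDot k).lTensor (H k) (d t)) = t.toH k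

namespace IsCoaction

variable {Θ : HCK k →ₐ[k] H k ⊗[k] HCK k} {d : RTree → H k ⊗[k] H k}

/-- Both sides are algebra morphisms in `x`, and both vanish on trees by `counitCK_comp_incl`. -/
theorem rid_counitCK (h : IsCoaction Θ d) (x : HCK k) :
    TensorProduct.rid k (H k) ((counitCK k).lTensor (H k) (Θ x)) =
      algebraMap k (H k) (augCK k x) := by
  have key : ((Algebra.TensorProduct.rid k k (H k)).toAlgHom.comp
      ((Algebra.TensorProduct.map (AlgHom.id k (H k)) (augCK k)).comp Θ)) =
      (Algebra.ofId k (H k)).comp (augCK k) := by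
    refine MvPolynomial.algHom_ext fun t => ?_
    have h1 : (Algebra.TensorProduct.map (AlgHom.id k (H k)) (augCK k)) (Θ (MvPolynomial.X t)) =
        (counitCK k).lTensor (H k) (Θ (MvPolynomial.X t)) := by
      rw [← augCK_toLinearMap]; rfl
    have h2 : augCK k (MvPolynomial.X t) = 0 := by simp [augCK]
    rw [AlgHom.comp_apply, AlgHom.comp_apply, AlgHom.comp_apply, h1, h.map_X, h2, map_zero,
      ← LinearMap.lTensor_comp_apply, counitCK_comp_incl, LinearMap.lTensor_zero,
      LinearMap.zero_apply, map_zero]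
  have := DFunLike.congr_fun key x
  rw [← augCK_toLinearMap]
  exact this

/-- An algebra morphism that fixes every tree is the identity; on trees, `incl` commutes with
contracting the left factor, and the left co-unit law applies. -/
theorem lid_ZDot_apply (h : IsCoaction Θ d) (x : HCK k) :
    TensorProduct.lid k (HCK k) ((ZDot k).rTensor (HCK k) (Θ x)) = x := by
  have key : ((Algebra.TensorProduct.lid k (HCK k)).toAlgHom.comp
      ((Algebra.TensorProduct.map (augH k) (AlgHom.id k (HCK k))).comp Θ)) =
      AlgHom.id k (HCK k) := by
    refine MvPolynomial.algHom_ext fun t => ?_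
    have h1 : (Algebra.TensorProduct.map (augH k) (AlgHom.id k (HCK k))) (Θ (MvPolynomial.X t)) =
        (ZDot k).rTensor (HCK k) (Θ (MvPolynomial.X t)) := by
      rw [← augH_toLinearMap]; rfl
    have h2 : ∀ z : H k ⊗[k] H k, TensorProduct.lid k (HCK k)
        ((ZDot k).rTensor (HCK k) ((incl k).lTensor (H k) z)) =
        incl k (TensorProduct.lid k (H k) ((ZDot k).rTensor (H k) z)) := by
      intro z
      induction z with
      | zero => simp
      | add x y hx hy => simp only [map_add, hx, hy]
      | tmul x y => simp
    rw [AlgHom.comp_apply, AlgHom.comp_apply, h1, h.map_X]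
    exact (h2 (d t)).trans (by rw [h.lid_ZDot, incl_toH]; rfl)
  have := DFunLike.congr_fun key x
  rw [← augH_toLinearMap]
  exact this

theorem rid_deltaDot_mul (z w : H k ⊗[k] HCK k) :
    TensorProduct.rid k (H k) ((deltaDot k).lTensor (H k) (z * w)) =
      TensorProduct.rid k (H k) ((counitCK k).lTensor (H k) z) *
        TensorProduct.rid k (H k) ((deltaDot k).lTensor (H k) w) +
      TensorProduct.rid k (H k) ((deltaDot k).lTensor (H k) z) *
        TensorProduct.rid k (H k) ((counitCK k).lTensor (H k) w) := by
  induction z with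
  | zero => simp
  | add x y hx hy => simp only [map_add, add_mul, hx, hy]; ring
  | tmul x y =>
    induction w with
    | zero => simp
    | add u v hu hv => simp only [map_add, mul_add, hu, hv]; ring
    | tmul u v =>
      simp only [Algebra.TensorProduct.tmul_mul_tmul, LinearMap.lTensor_tmul,
        TensorProduct.rid_tmul, deltaDot_mul, counitCK_apply, add_smul, smul_mul_smul_comm]

theorem apply_counitCK (h : IsCoaction Θ d) (α : H k →ₗ[k] k) (x : HCK k) :
    LinearMap.mul' k k (TensorProduct.map α (counitCK k) (Θ x)) = α 1 * counitCK k x := by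
  rw [mul'_map_eq_rid, h.rid_counitCK, Algebra.algebraMap_eq_smul_one, map_smul, smul_eq_mul,
    mul_comm, counitCK_apply]

theorem apply_deltaDot (h : IsCoaction Θ d) (α : H k →ₗ[k] k) (x : HCK k) :
    LinearMap.mul' k k (TensorProduct.map α (deltaDot k) (Θ x)) = onTrees α x := by
  rw [mul'_map_eq_rid]
  -- The derivation rule at `1 * 1` reads `D = D + D`, so `D` vanishes at `1`.
  have h1 : TensorProduct.rid k (H k) ((deltaDot k).lTensor (H k) (1 : H k ⊗[k] HCK k)) = 0 := by
    have := rid_deltaDot_mul (k := k) 1 1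
    have h2 := h.rid_counitCK 1
    simp only [map_one] at h2
    simpa [h2] using this
  induction x using MvPolynomial.induction_on with
  | C a =>
    have : (MvPolynomial.C a : HCK k) = a • 1 := by
      rw [MvPolynomial.smul_eq_C_mul, mul_one]
    rw [this]
    simp only [map_smul, map_one, h1, onTrees_one, map_zero]
  | add p q hp hq => simp only [map_add, hp, hq]
  | mul_X p t _ =>
    have h2 : TensorProduct.rid k (H k) ((deltaDot k).lTensor (H k) (Θ (MvPolynomial.X t))) =
        t.toH k := by
      rw [h.map_X, ← LinearMap.lTensor_comp_apply, deltaDot_comp_incl, h.rid_ZDot]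
    have h3 : augCK k (MvPolynomial.X t) = 0 := by simp [augCK]
    -- Since the co-unit kills `t`, only the term that differentiates `t` survives, and no induction
    -- hypothesis on `p` is needed.
    rw [map_mul, rid_deltaDot_mul, h.rid_counitCK, h.rid_counitCK, h2, h3, map_zero, mul_zero,
      add_zero, onTrees_mul_X, Algebra.algebraMap_eq_smul_one, smul_one_mul, map_smul, smul_eq_mul]

theorem ZDot_apply (h : IsCoaction Θ d) (b : HCK k →ₗ[k] k) (x : HCK k) :
    LinearMap.mul' k k (TensorProduct.map (ZDot k) b (Θ x)) = b x := by
  rw [mul'_map_eq_lid, h.lid_ZDot_apply]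

end IsCoaction

variable (k)

theorem isCoaction_Phi : IsCoaction (Phi k) fun t => coproduct k (t.toH k) :=
  ⟨Phi_X k, lid_ZDot_coproduct k, rid_ZDot_coproduct k⟩

/-- Flipping the tensor factors exchanges the two co-unit laws of `coproduct`. -/
theorem isCoaction_Psi :
    IsCoaction ((Algebra.TensorProduct.comm k (HCK k) (H k)).toAlgHom.comp (Psi k))
      fun t => TensorProduct.comm k (H k) (H k) (coproduct k (t.toH k)) where
  map_X t := by
    rw [AlgHom.comp_apply, Psi_X]
    exact (LinearMap.lTensor_comm ..).symm
  lid_ZDot t := by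
    refine Eq.trans ?_ (rid_ZDot_coproduct k t)
    generalize coproduct k (t.toH k) = z
    induction z with
    | zero => simp
    | add x y hx hy => simp only [map_add, hx, hy]
    | tmul x y => simp
  rid_ZDot t := by
    refine Eq.trans ?_ (lid_ZDot_coproduct k t)
    generalize coproduct k (t.toH k) = z
    induction z with
    | zero => simp
    | add x y hx hy => simp only [map_add, hx, hy]
    | tmul x y => simp

variable {k}

theorem actR_apply (b : HCK k →ₗ[k] k) (α : H k →ₗ[k] k) (x : HCK k) :
    actR b α x = LinearMap.mul' k k (TensorProduct.map α b
      (((Algebra.TensorProduct.comm k (HCK k) (H k)).toAlgHom.comp (Psi k)) x)) :=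
  mul'_map_comm α b (Psi k x)

theorem actL_apply (α : H k →ₗ[k] k) (b : HCK k →ₗ[k] k) (x : HCK k) :
    actL α b x = LinearMap.mul' k k (TensorProduct.map α b (Phi k x)) := rfl

end Coaction

/-! ### Acting by a character -/

section Twist

variable {k}

/-- The endomorphism `(φ ⊗ id) ∘ Φ` of the algebra `HCK`. -/
def twist (φ : H k →ₐ[k] k) : HCK k →ₐ[k] HCK k :=
  (Algebra.TensorProduct.lid k (HCK k)).toAlgHom.comp
    ((Algebra.TensorProduct.map φ (AlgHom.id k (HCK k))).comp (Phi k))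

theorem actL_eq_comp_twist (φ : H k →ₐ[k] k) (b : HCK k →ₗ[k] k) :
    actL φ.toLinearMap b = b ∘ₗ (twist φ).toLinearMap := by
  refine LinearMap.ext fun x => ?_
  rw [actL_apply, mul'_map_eq_lid]
  rfl

theorem twist_toHCK (φ : H k →ₐ[k] k) (F : Forest) :
    twist φ (F.toHCK k) = ∑ S ∈ F.edges.powerset,
      φ ((F.spanning S).toH k) • (F.contract S).toHCK k := by
  simp [twist, Phi_toHCK]

/-- The endomorphism `(φ ⊗ id) ∘ Φ` is compatible with the coproduct. -/
theorem coproductCK_comp_twist (φ : H k →ₐ[k] k) :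
    (coproductCK k).comp (twist φ) =
      (Algebra.TensorProduct.map (twist φ) (twist φ)).comp (coproductCK k) := by
  refine MvPolynomial.algHom_ext fun t => ?_
  rw [AlgHom.comp_apply, AlgHom.comp_apply, ← toHCK_rep, twist_toHCK, coproductCK_toHCK]
  simp only [map_sum, map_smul, coproductCK_toHCK, Algebra.TensorProduct.map_tmul, twist_toHCK,
    Finset.smul_sum]
  have hq := (isMultiplicative_toH k).comp (φ : H k →* k)
  -- The weight of a spanning subforest is its value under `φ`, which is multiplicative because `φ`
  -- is a character.
  refine (Forest.sum_edges_crowns hq (fun F G => F.toHCK k ⊗ₜ[k] G.toHCK k) t.rep).trans ?_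
  refine Finset.sum_congr rfl fun V _ => ?_
  rw [Finset.sum_product, TensorProduct.sum_tmul]
  refine Finset.sum_congr rfl fun S _ => ?_
  rw [TensorProduct.tmul_sum]
  refine Finset.sum_congr rfl fun T _ => ?_
  rw [TensorProduct.smul_tmul_smul]
  rfl

theorem actL_conv (φ : H k →ₐ[k] k) (b c : HCK k →ₗ[k] k) :
    actL φ.toLinearMap (conv b c) = conv (actL φ.toLinearMap b) (actL φ.toLinearMap c) := by
  simp only [actL_eq_comp_twist]
  refine LinearMap.ext fun x => ?_
  have h := DFunLike.congr_fun (coproductCK_comp_twist φ) x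
  simp only [AlgHom.comp_apply] at h
  simp only [conv, LinearMap.comp_apply, AlgHom.toLinearMap_apply, h, TensorProduct.map_comp]
  rfl

end Twist

/-! ### The convolution monoid and its inverses -/

section Convolution

variable {k}

/-- Both sides are algebra morphisms; on a tree they are the two descriptions of cuts into three
layers. -/
theorem coproductCK_coassoc :
    ((Algebra.TensorProduct.assoc k k k (HCK k) (HCK k) (HCK k)).toAlgHom.comp
      ((Algebra.TensorProduct.map (coproductCK k) (AlgHom.id k _)).comp (coproductCK k))) =
    (Algebra.TensorProduct.map (AlgHom.id k _) (coproductCK k)).comp (coproductCK k) := by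
  refine MvPolynomial.algHom_ext fun t => ?_
  simp only [AlgHom.comp_apply, ← toHCK_rep, coproductCK_toHCK, map_sum,
    Algebra.TensorProduct.map_tmul, TensorProduct.sum_tmul, TensorProduct.tmul_sum, AlgHom.id_apply]
  exact Forest.sum_crowns_crowns t.rep
    fun A B C => A.toHCK k ⊗ₜ[k] (B.toHCK k ⊗ₜ[k] C.toHCK k)

theorem conv_assoc (a b c : HCK k →ₗ[k] k) : conv (conv a b) c = conv a (conv b c) := by
  refine LinearMap.ext fun x => ?_
  have h := DFunLike.congr_fun (coproductCK_coassoc (k := k)) x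
  have h1 : ∀ z : HCK k ⊗[k] HCK k,
      LinearMap.mul' k k (TensorProduct.map (conv a b) c z) =
      LinearMap.mul' k k (TensorProduct.map a (LinearMap.mul' k k ∘ₗ TensorProduct.map b c)
        (Algebra.TensorProduct.assoc k k k (HCK k) (HCK k) (HCK k)
          (Algebra.TensorProduct.map (coproductCK k) (AlgHom.id k _) z))) := by
    intro z
    induction z with
    | zero => simp
    | add x y hx hy => simp only [map_add, hx, hy]
    | tmul x y =>
      simp only [TensorProduct.map_tmul, conv, LinearMap.comp_apply, AlgHom.toLinearMap_apply,
        Algebra.TensorProduct.map_tmul, AlgHom.id_apply, LinearMap.mul'_apply]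
      generalize coproductCK k x = w
      induction w with
      | zero => simp
      | add u v hu hv => simp only [map_add, TensorProduct.add_tmul, add_mul, hu, hv]
      | tmul u v => simp [mul_assoc]
  have h2 : ∀ z : HCK k ⊗[k] HCK k,
      LinearMap.mul' k k (TensorProduct.map a (conv b c) z) =
      LinearMap.mul' k k (TensorProduct.map a (LinearMap.mul' k k ∘ₗ TensorProduct.map b c)
          (Algebra.TensorProduct.map (AlgHom.id k _) (coproductCK k) z)) := by
    intro z
    induction z with
    | zero => simp
    | add x y hx hy => simp only [map_add, hx, hy]
    | tmul x y => simp [conv]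
  refine (h1 (coproductCK k x)).trans (Eq.trans ?_ (h2 (coproductCK k x)).symm)
  exact congrArg (fun z => LinearMap.mul' k k
    (TensorProduct.map a (LinearMap.mul' k k ∘ₗ TensorProduct.map b c) z)) h

theorem augCK_toHCK (F : Forest) : augCK k (F.toHCK k) = if F.verts = ∅ then 1 else 0 := by
  split_ifs with h
  · rw [(isMultiplicative_toHCK k).map_empty F h, map_one]
  · obtain ⟨x, hx⟩ := Finset.nonempty_iff_ne_empty.2 h
    obtain ⟨r, hr, -⟩ := F.exists_root_le hx
    rw [Forest.toHCK, map_prod]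
    exact Finset.prod_eq_zero (Finset.mem_univ ⟨r, hr⟩) (by simp [augCK])

theorem counitCK_conv (b : HCK k →ₗ[k] k) : conv (counitCK k) b = b := by
  have key : (Algebra.TensorProduct.lid k (HCK k)).toAlgHom.comp
      ((Algebra.TensorProduct.map (augCK k) (AlgHom.id k (HCK k))).comp (coproductCK k)) =
      AlgHom.id k (HCK k) := by
    refine MvPolynomial.algHom_ext fun t => ?_
    rw [← toHCK_rep]
    simp only [AlgHom.comp_apply, coproductCK_toHCK, map_sum, Algebra.TensorProduct.map_tmul,
      augCK_toHCK, AlgHom.id_apply]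
    rw [Finset.sum_eq_single ∅]
    · simp [Forest.eq_of_verts_le (F := t.rep.restrict t.rep.verts) (G := t.rep) (by simp) rfl]
    · intro V hV hne
      have hV' := (Forest.mem_crowns.1 hV).1
      rw [Forest.restrict_verts_of_subset hV', if_neg hne, TensorProduct.zero_tmul, map_zero]
    · exact fun h => absurd (Forest.mem_crowns.2 t.rep.isUpper_empty) h
  refine LinearMap.ext fun x => ?_
  refine (mul'_map_eq_lid _ _ _).trans (congrArg b ?_)
  rw [← augCK_toLinearMap]
  exact DFunLike.congr_fun key x

theorem conv_counitCK (b : HCK k →ₗ[k] k) : conv b (counitCK k) = b := by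
  have key : (Algebra.TensorProduct.rid k k (HCK k)).toAlgHom.comp
      ((Algebra.TensorProduct.map (AlgHom.id k (HCK k)) (augCK k)).comp (coproductCK k)) =
      AlgHom.id k (HCK k) := by
    refine MvPolynomial.algHom_ext fun t => ?_
    rw [← toHCK_rep]
    simp only [AlgHom.comp_apply, coproductCK_toHCK, map_sum, Algebra.TensorProduct.map_tmul,
      augCK_toHCK, AlgHom.id_apply]
    rw [Finset.sum_eq_single t.rep.verts]
    · simp [Forest.eq_of_verts_le (F := t.rep.restrict t.rep.verts) (G := t.rep) (by simp) rfl]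
    · intro V hV hne
      have hV' := (Forest.mem_crowns.1 hV).1
      rw [Forest.restrict_verts_of_subset Finset.sdiff_subset, if_neg, TensorProduct.tmul_zero,
        map_zero]
      exact fun h => hne (Finset.Subset.antisymm hV' (Finset.sdiff_eq_empty_iff_subset.1 h))
    · exact fun h => absurd (Forest.mem_crowns.2
        ⟨Finset.Subset.refl _, fun _ _ y hy _ => hy⟩) h
  refine LinearMap.ext fun x => ?_
  refine (mul'_map_eq_rid _ _ _).trans (congrArg b ?_)
  rw [← augCK_toLinearMap]
  exact DFunLike.congr_fun key x

theorem IsConvInverse.unique {b c d : HCK k →ₗ[k] k} (hc : IsConvInverse b c)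
    (hd : IsConvInverse b d) : d = c := by
  rw [← conv_counitCK d, ← hc.1, ← conv_assoc, hd.2, counitCK_conv]

theorem actL_counitCK (α : H k →ₗ[k] k) : actL α (counitCK k) = α 1 • counitCK k :=
  LinearMap.ext fun x => (isCoaction_Phi k).apply_counitCK α x

theorem IsConvInverse.actL {b b' : HCK k →ₗ[k] k} (h : IsConvInverse b b') (φ : H k →ₐ[k] k) :
    IsConvInverse (actL φ.toLinearMap b) (actL φ.toLinearMap b') := by
  -- Unitality of `φ` makes the action fix the unit for `*`.
  have hε : TreeHopf.actL φ.toLinearMap (counitCK k) = counitCK k := by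
    rw [actL_counitCK, AlgHom.toLinearMap_apply, map_one, one_smul]
  exact ⟨by rw [← actL_conv, h.1, hε], by rw [← actL_conv, h.2, hε]⟩

end Convolution

end TreeHopf
end

open TreeHopf
theorem mainTheorem3 (k : Type*) [Field k] [CharZero k]
    (φ : H k →ₐ[k] k) (α : H k →ₗ[k] k) (b c : HCK k →ₗ[k] k) :
    (actL α (counitCK k) = α 1 • counitCK k ∧ actR (counitCK k) α = α 1 • counitCK k) ∧
    (actL α (deltaDot k) = onTrees α ∧ actR (deltaDot k) α = onTrees α) ∧
    (actL (ZDot k) b = b ∧ actR b (ZDot k) = b) ∧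
    actL φ.toLinearMap (conv b c) = conv (actL φ.toLinearMap b) (actL φ.toLinearMap c) ∧
    (∀ b' : HCK k →ₗ[k] k, IsConvInverse b b' →
      ∀ d : HCK k →ₗ[k] k,
        IsConvInverse (actL φ.toLinearMap b) d ↔ d = actL φ.toLinearMap b') := by
  refine ⟨⟨actL_counitCK α, LinearMap.ext fun x => ?_⟩,
    ⟨LinearMap.ext fun x => (isCoaction_Phi k).apply_deltaDot α x, LinearMap.ext fun x => ?_⟩,
    ⟨LinearMap.ext fun x => (isCoaction_Phi k).ZDot_apply b x, LinearMap.ext fun x => ?_⟩,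
    actL_conv φ b c, fun b' hb d => ⟨fun hd => (hb.actL φ).unique hd, ?_⟩⟩
  · rw [actR_apply]; exact (isCoaction_Psi k).apply_counitCK α x
  · rw [actR_apply]; exact (isCoaction_Psi k).apply_deltaDot α x
  · rw [actR_apply]; exact (isCoaction_Psi k).ZDot_apply b x
  · rintro rfl
    exact hb.actL φ
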